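/- **Setting.** Let $(I,\mathbb A,m)$ be a measure space with $m(I)<\infty$; write $|Q|=m(Q)$. Let $0<c_1<c_2<1$ and let $\mathcal P=(\mathcal P^k)_{k\ge 0}$ be a $(c_1,c_2)$-good grid: each $\mathcal P^k$ is a finite family of measurable sets of positive measure, no set belongs to two different levels, $C_{\mathcal P}=\sup_k\sup_{Q\in\mathcal P^k}\#\{P\in\mathcal P^k: P\cap Q\neq\emptyset\}<\infty$, and - $\mathcal P^0=\{I\}$; for every $k$ the sets of $\mathcal P^k$ are pairwise disjoint and cover $I$ up to a null set; - every $Q\in\mathcal P^{k+1}$ is contained in some $P\in\mathcal P^{k}$, and $c_1\le |Q|/|P|\le c_2$ whenever $Q\in\mathcal P^{k+1}$, $P\in\mathcal P^k$, $Q\subset P$; - $\bigcup_k\mathcal P^k$ generates $\mathbb A$. Put $|\mathcal P^k|=\max_{Q\in\mathcal P^k}|Q|$. Let $p\in[1,\infty)$, $q\in[1,\infty]$, $0<s<1/p$. An $(s,p)$-Souza atom on $Q$ is a function $a\colon I\to\mathbb C$ that vanishes off $Q$, is constant on $Q$, and satisfies $|a|_\infty\le |Q|^{s-1/p}$. The space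 $\mathcal B^s_{p,q}$ consists of all complex functions $g\in L^p$ (modulo a.e. equality) that have a representation $$g=\sum_{k\ge0}\sum_{Q\in\mathcal P^k}c_Q a_Q,\qquad c_Q\in\mathbb C,\ a_Q \text{ an } (s,p)\text{-Souza atom on } Q,$$ converging absolutely in $L^p$, that is, $\sum_k\big|\sum_{Q\in\mathcal P^k}c_Qa_Q\big|_p<\infty$, with finite cost $$\Big(\sum_k\Big(\sum_{Q\in\mathcal P^k}|c_Q|^p\Big)^{q/p}\Big)^{1/q}$$ (a supremum over $k$ if $q=\infty$); $|g|_{\mathcal B^s_{p,q}}$ is the infimum of the costs of all such representations of $g$. **Constants.** With $1/q+1/q'=1$ let $$C_2=\frac{c_2^{1/2}}{\sqrt2\,c_1^{3/2}}+1,\qquad C_e=1+C_2\max\{c_2^{1/p-s},c_1^{1/p-s}\}\,c_1^{-2-1/p},$$ $$C_{no}=C_{\mathcal P}^{1+1/p}\Big(\sum_k|\mathcal P^k|^{sq'}\Big)^{1/q'}|I|^{-s}+\frac1{1-c_2^s},$$ where $\big(\sum_k|\mathcal P^k|^{sq'}\big)^{1/q'}$ is read as $\sup_k|\mathcal P^k|^s$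 if $q=1$. **Proposition 17.1 (Pointwise multipliers III).** The constant $C_eC_{no}$ is finite. If $f,g\in\mathcal B^s_{p,q}\cap L^\infty$, then $fg\in\mathcal B^s_{p,q}\cap L^\infty$ and $$|fg|_{\mathcal B^s_{p,q}}+|fg|_\infty\le C_eC_{no}\,\big(|f|_{\mathcal B^s_{p,q}}+|f|_\infty\big)\big(|g|_{\mathcal B^s_{p,q}}+|g|_\infty\big).$$ Consequently $\mathcal B^s_{p,q}\cap L^\infty$ is a quasi-Banach algebra: it is a complex linear space closed under products, $|\cdot|_{\mathcal B^s_{p,q}}+|\cdot|_\infty$ is a complete norm on it, and the norm of a product is at most a finite constant times the product of the norms. -/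

import Mathlib

open MeasureTheory Filter Topology
open scoped ENNReal NNReal

namespace GridBesov

/-- The quantity `sup_k sup_{Q ∈ 𝓖^k} #{P ∈ 𝓖^k : P ∩ Q ≠ ∅}` of a sequence of finite families of
sets. -/
noncomputable def overlap {I : Type*} (F : ℕ → Finset (Set I)) : ℝ≥0∞ :=
  ⨆ (k : ℕ) (Q ∈ F k), (({P : Set I | P ∈ F k ∧ (P ∩ Q).Nonempty}.encard : ℕ∞) : ℝ≥0∞)

/-- A grid of the measure space `(I, m)`: a sequence of finite families of measurable sets with
positive measure, not all empty, with uniformly bounded overlap inside each level, and such that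
no set occurs in two different levels. -/
structure Grid {I : Type*} [MeasurableSpace I] (m : Measure I) where
  /-- The family of sets at level `k`. -/
  sets : ℕ → Finset (Set I)
  measurableSet : ∀ k, ∀ Q ∈ sets k, MeasurableSet Q
  measure_pos : ∀ k, ∀ Q ∈ sets k, 0 < m Q
  exists_nonempty : ∃ k, (sets k).Nonempty
  overlap_lt_top : overlap sets < ∞
  ne_of_level_ne : ∀ i j, i ≠ j → ∀ P ∈ sets i, ∀ Q ∈ sets j, P ≠ Q

/-- `(c₁, c₂)`-good grids. -/
structure Grid.IsGood {I : Type*} [mI : MeasurableSpace I] {m : Measure I} (𝓖 : Grid m)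
    (c₁ c₂ : ℝ) : Prop where
  pos : 0 < c₁
  lt : c₁ < c₂
  lt_one : c₂ < 1
  level_zero : 𝓖.sets 0 = {Set.univ}
  /-- Each level covers the space up to a null set. -/
  cover : ∀ k, m (⋃ Q ∈ 𝓖.sets k, Q)ᶜ = 0
  disjoint : ∀ k, ∀ P ∈ 𝓖.sets k, ∀ Q ∈ 𝓖.sets k, P ≠ Q → Disjoint P Q
  nested : ∀ k, ∀ Q ∈ 𝓖.sets (k + 1), ∃ P ∈ 𝓖.sets k, Q ⊆ P
  ratio : ∀ k, ∀ Q ∈ 𝓖.sets (k + 1), ∀ P ∈ 𝓖.sets k, Q ⊆ P →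
    c₁ ≤ m.real Q / m.real P ∧ m.real Q / m.real P ≤ c₂
  /-- The sets of the grid generate the σ-algebra of the space. -/
  generate : MeasurableSpace.generateFrom {Q : Set I | ∃ k, Q ∈ 𝓖.sets k} = mI

/-- `|𝓖^k|`, the largest measure of a set of level `k`. -/
noncomputable def Grid.mesh {I : Type*} [MeasurableSpace I] {m : Measure I} (𝓖 : Grid m)
    (k : ℕ) : ℝ≥0∞ :=
  ⨆ Q ∈ 𝓖.sets k, m Q

/-- The `(s,p)`-Souza atoms supported on `Q`: functions vanishing off `Q` and constant on `Q`, with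
`|a|_∞ ≤ |Q|^{s - 1/p}`. -/
def souzaAtoms {I : Type*} [MeasurableSpace I] (m : Measure I) (s p : ℝ) (Q : Set I) :
    Set (I → ℂ) :=
  {a | (∀ x, x ∉ Q → a x = 0) ∧ (∃ z : ℂ, ∀ x ∈ Q, a x = z) ∧
    eLpNorm a ∞ m ≤ m Q ^ (s - 1 / p)}

/-- The cost `(∑_k (∑_{Q ∈ 𝓖^k} |c_Q|^p)^{q/p})^{1/q}`, a supremum over `k` if `q = ∞`. -/
noncomputable def Grid.cost {I : Type*} [MeasurableSpace I] {m : Measure I} (𝓖 : Grid m)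
    (p : ℝ) (q : ℝ≥0∞) (c : Set I → ℂ) : ℝ≥0∞ :=
  if q = ∞ then ⨆ k : ℕ, (∑ Q ∈ 𝓖.sets k, ‖c Q‖ₑ ^ p) ^ (1 / p)
  else (∑' k : ℕ, (∑ Q ∈ 𝓖.sets k, ‖c Q‖ₑ ^ p) ^ (q.toReal / p)) ^ (1 / q.toReal)

/-- `g = ∑_k ∑_{Q ∈ 𝓖^k} c_Q a_Q` is a representation of `g ∈ L^p` by the atoms `𝒜`: the `a_Q` are
atoms, the cost is finite, and the series converges absolutely in `L^p`, with sum `g`.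
Coefficients and atoms are indexed by sets; only their values on the sets of the grid matter. -/
structure Grid.IsRep {I : Type*} [MeasurableSpace I] {m : Measure I} (𝓖 : Grid m)
    (𝒜 : Set I → Set (I → ℂ)) (p : ℝ) (q : ℝ≥0∞) (g : I →ₘ[m] ℂ)
    (c : Set I → ℂ) (a : Set I → I → ℂ) : Prop where
  memLp : MemLp g (ENNReal.ofReal p) m
  atom : ∀ k, ∀ Q ∈ 𝓖.sets k, a Q ∈ 𝒜 Q
  cost_lt_top : 𝓖.cost p q c < ∞
  absConv : ∑' k : ℕ, eLpNorm (fun x => ∑ Q ∈ 𝓖.sets k, c Q * a Q x) (ENNReal.ofReal p) m ^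
    (p / max p 1) < ∞
  tendsto : Tendsto (fun n : ℕ => eLpNorm
    (fun x => g x - ∑ k ∈ Finset.range n, ∑ Q ∈ 𝓖.sets k, c Q * a Q x) (ENNReal.ofReal p) m)
    atTop (𝓝 0)

/-- The space `𝓑^s_{p,q}` of the grid, built on Souza atoms; functions are identified when they
agree almost everywhere. -/
def Grid.besov {I : Type*} [MeasurableSpace I] {m : Measure I} (𝓖 : Grid m)
    (s p : ℝ) (q : ℝ≥0∞) : Set (I →ₘ[m] ℂ) :=
  {g | ∃ c a, 𝓖.IsRep (souzaAtoms m s p) p q g c a}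

/-- The norm of `𝓑^s_{p,q}`: the infimum of the costs of all representations (`∞` if there is
none). -/
noncomputable def Grid.besovNorm {I : Type*} [MeasurableSpace I] {m : Measure I} (𝓖 : Grid m)
    (s p : ℝ) (q : ℝ≥0∞) (g : I →ₘ[m] ℂ) : ℝ≥0∞ :=
  ⨅ (c : Set I → ℂ) (a : Set I → I → ℂ) (_ : 𝓖.IsRep (souzaAtoms m s p) p q g c a), 𝓖.cost p q c

/-- The space `𝓑^s_{p,q} ∩ L^∞`. -/
def Grid.besovLinfty {I : Type*} [MeasurableSpace I] {m : Measure I} (𝓖 : Grid m)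
    (s p : ℝ) (q : ℝ≥0∞) : Set (I →ₘ[m] ℂ) :=
  {g | g ∈ 𝓖.besov s p q ∧ MemLp g ∞ m}

/-- The norm `|g|_{𝓑^s_{p,q}} + |g|_∞`. -/
noncomputable def Grid.besovLinftyNorm {I : Type*} [MeasurableSpace I] {m : Measure I}
    (𝓖 : Grid m) (s p : ℝ) (q : ℝ≥0∞) (g : I →ₘ[m] ℂ) : ℝ≥0∞ :=
  𝓖.besovNorm s p q g + eLpNorm g ∞ m

/-- The set `S` of (classes of) measurable functions, with the functional `N` and the pointwise
operations, is a quasi-Banach algebra: it is a linear subspace closed under products, `N` is a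
complete norm on it, and `N (f * g) ≤ C * N f * N g` for some finite constant `C` (which need not
be `1`). -/
structure IsQuasiBanachAlgebra {I : Type*} [MeasurableSpace I] {m : Measure I}
    (S : Set (I →ₘ[m] ℂ)) (N : (I →ₘ[m] ℂ) → ℝ≥0∞) : Prop where
  zero_mem : (0 : I →ₘ[m] ℂ) ∈ S
  add_mem : ∀ f ∈ S, ∀ g ∈ S, f + g ∈ S
  smul_mem : ∀ (z : ℂ), ∀ f ∈ S, z • f ∈ S
  mul_mem : ∀ f ∈ S, ∀ g ∈ S, f * g ∈ S
  lt_top : ∀ f ∈ S, N f < ∞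
  eq_zero_iff : ∀ f ∈ S, N f = 0 ↔ f = 0
  smul_eq : ∀ (z : ℂ), ∀ f ∈ S, N (z • f) = ‖z‖ₑ * N f
  add_le : ∀ f ∈ S, ∀ g ∈ S, N (f + g) ≤ N f + N g
  mul_le : ∃ C : ℝ≥0, ∀ f ∈ S, ∀ g ∈ S, N (f * g) ≤ C * N f * N g
  complete : ∀ u : ℕ → (I →ₘ[m] ℂ), (∀ n, u n ∈ S) →
    (∀ ε : ℝ≥0∞, 0 < ε → ∃ n₀, ∀ i ≥ n₀, ∀ j ≥ n₀, N (u i - u j) < ε) →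
    ∃ f ∈ S, Tendsto (fun n => N (u n - f)) atTop (𝓝 0)

/-- The Hölder constant of the sequence `b`, for `t, q ≥ 1`: `(∑_k b_k^{q'/t})^{1/q'}` with
`1/q + 1/q' = 1` if `q > 1` (so `q' = 1` if `q = ∞`), and `sup_k b_k^{1/t}` if `q = 1`. -/
noncomputable def holderConst (t : ℝ) (q : ℝ≥0∞) (b : ℕ → ℝ≥0∞) : ℝ≥0∞ :=
  if q = 1 then ⨆ k, b k ^ (1 / t)
  else (∑' k, b k ^ ((ENNReal.conjExponent q).toReal / t)) ^ (1 / (ENNReal.conjExponent q).toReal)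

/-- `c₂^{1/2} / (√2 c₁^{3/2}) + 1`, the bound of the Haar functions of a `(c₁, c₂)`-good grid. -/
noncomputable def haarConst (c₁ c₂ : ℝ) : ℝ :=
  c₂ ^ (1 / 2 : ℝ) / (√2 * c₁ ^ (3 / 2 : ℝ)) + 1

/-- `1 + C max {c₂^{1/p-s}, c₁^{1/p-s}} c₁^{-2-1/p}` with `C` the constant of the Haar functions:
it compares the Haar coefficients of a function with its standard atomic representation. -/
noncomputable def stdConst (c₁ c₂ s p : ℝ) : ℝ :=
  1 + haarConst c₁ c₂ * max (c₂ ^ (1 / p - s)) (c₁ ^ (1 / p - s)) * c₁ ^ (-2 - 1 / p)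

/-- The constant that compares the mean oscillation of a function with its Besov norm. -/
noncomputable def Grid.oscConst {I : Type*} [MeasurableSpace I] {m : Measure I} (𝓖 : Grid m)
    (c₂ s p : ℝ) (q : ℝ≥0∞) : ℝ≥0∞ :=
  overlap 𝓖.sets ^ (1 + 1 / p) * holderConst p q (fun k => 𝓖.mesh k ^ (s * p)) *
      m Set.univ ^ (-s) +
    ENNReal.ofReal (1 / (1 - c₂ ^ s))

end GridBesov

/-! Work with the averages of `f` over the sets of the grid, and with the increments of these
averages from each set to its parent. The weighted `ℓ^q(ℓ^p)` norm of the increments, `incrNorm`, is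
equivalent to the Besov norm. On one side, the increments of any values `v` on the grid are the
coefficients of a Souza representation whose partial sums telescope to the step functions of `v`, so
`besovNorm` is at most `incrNorm` as soon as these step functions converge to the function in `L^p`
(`besovNorm_le_incrNorm`). On the other side, the layer of level `j` of a representation contributes
nothing to increments at levels above `j`, and a contribution damped by `(c₂^s)^(j-k)` at levels `k
≤ j`; Young's inequality for this geometric kernel gives `incrNorm ≤ incrConst * besovNorm`
(`incrNorm_le_besovNorm`).

The product estimate is then a discrete Leibniz rule. The values chosen for `f * g` are the products
of the averages of `f` and of `g`, not the averages of `f * g`. Their increments split as `w(Q) Δv +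
v(P) Δw`, and averages are bounded by sup norms (`incrNorm_mul_le`); the step functions of these
products converge to `f * g` because both factors are bounded (`tendsto_step_mul`). The resulting
constant `incrConst` is at most the stated one (`incrConst_le`).

Completeness combines that of `L^∞` with the lower semicontinuity of `incrNorm` under convergence of
averages (`incrNorm_le_of_tendsto`). -/

namespace GridBesov

/-! ### Sequence norms with values in `[0, ∞]`. -/

/-- The `ℓ^q` norm of a sequence in `[0, ∞]`. -/
noncomputable def seqNorm (q : ℝ≥0∞) (a : ℕ → ℝ≥0∞) : ℝ≥0∞ :=
  if q = ∞ then ⨆ k, a k else (∑' k, a k ^ q.toReal) ^ (1 / q.toReal)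

theorem one_le_toReal_of_ne_top {q : ℝ≥0∞} (hq : 1 ≤ q) (h : q ≠ ∞) : 1 ≤ q.toReal := by
  simpa using (ENNReal.toReal_le_toReal ENNReal.one_ne_top h).2 hq

theorem seqNorm_mono {q : ℝ≥0∞} {a b : ℕ → ℝ≥0∞} (h : ∀ k, a k ≤ b k) :
    seqNorm q a ≤ seqNorm q b := by
  unfold seqNorm
  split_ifs
  · exact iSup_mono h
  · gcongr with k
    exact h k

theorem le_seqNorm {q : ℝ≥0∞} (hq : 1 ≤ q) (a : ℕ → ℝ≥0∞) (k : ℕ) : a k ≤ seqNorm q a := by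
  unfold seqNorm
  split_ifs with h
  · exact le_iSup a k
  · have h1 := one_le_toReal_of_ne_top hq h
    rw [one_div, ENNReal.le_rpow_inv_iff (by linarith)]
    exact ENNReal.le_tsum (f := fun k => a k ^ q.toReal) k

theorem seqNorm_le_iff {q : ℝ≥0∞} (hq : 1 ≤ q) (a : ℕ → ℝ≥0∞) (C : ℝ≥0∞) (h : q ≠ ∞) :
    seqNorm q a ≤ C ↔ ∀ n, (∑ k ∈ Finset.range n, a k ^ q.toReal) ^ (1 / q.toReal) ≤ C := by
  have h1 := one_le_toReal_of_ne_top hq h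
  simp only [seqNorm, if_neg h, one_div, ENNReal.rpow_inv_le_iff (by linarith : 0 < q.toReal)]
  exact ⟨fun H n => (ENNReal.sum_le_tsum _).trans H, ENNReal.tsum_le_of_sum_range_le⟩

/-- Fatou's lemma for `ℓ^q`: a bound on the norm is a bound on all finite sections (on each term if
`q = ∞`), and these pass to the limit. -/
theorem seqNorm_le_of_tendsto {q : ℝ≥0∞} (hq : 1 ≤ q) {b : ℕ → ℕ → ℝ≥0∞} {a : ℕ → ℝ≥0∞}
    {C : ℝ≥0∞} (hb : ∀ k, Tendsto (fun n => b n k) atTop (𝓝 (a k)))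
    (h : ∀ᶠ n in atTop, seqNorm q (b n) ≤ C) : seqNorm q a ≤ C := by
  by_cases hT : q = ∞
  · simp only [seqNorm, if_pos hT] at h ⊢
    exact iSup_le fun k => le_of_tendsto (hb k) (h.mono fun n hn => (le_iSup _ k).trans hn)
  · rw [seqNorm_le_iff hq _ _ hT]
    intro N
    refine le_of_tendsto (f := fun n => (∑ k ∈ Finset.range N, b n k ^ q.toReal) ^ (1 / q.toReal))
      (x := atTop) ?_ (h.mono fun n hn => (seqNorm_le_iff hq _ _ hT).1 hn N)
    refine (ENNReal.continuous_rpow_const.tendsto _).comp ?_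
    exact tendsto_finsetSum _ fun k _ => (ENNReal.continuous_rpow_const.tendsto _).comp (hb k)

theorem seqNorm_add_le {q : ℝ≥0∞} (hq : 1 ≤ q) (a b : ℕ → ℝ≥0∞) :
    seqNorm q (fun k => a k + b k) ≤ seqNorm q a + seqNorm q b := by
  by_cases hT : q = ∞
  · simp only [seqNorm, if_pos hT]
    exact iSup_le fun k => add_le_add (le_iSup a k) (le_iSup b k)
  · rw [seqNorm_le_iff hq _ _ hT]
    intro n
    refine (ENNReal.Lp_add_le _ _ _ (one_le_toReal_of_ne_top hq hT)).trans ?_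
    exact add_le_add ((seqNorm_le_iff hq _ _ hT).1 le_rfl n) ((seqNorm_le_iff hq _ _ hT).1 le_rfl n)

theorem seqNorm_const_mul {q : ℝ≥0∞} (hq : 1 ≤ q) (C : ℝ≥0∞) (a : ℕ → ℝ≥0∞) :
    seqNorm q (fun k => C * a k) = C * seqNorm q a := by
  unfold seqNorm
  split_ifs with h
  · exact (ENNReal.mul_iSup ..).symm
  · have h1 := one_le_toReal_of_ne_top hq h
    have h0 : q.toReal ≠ 0 := by linarith
    simp_rw [ENNReal.mul_rpow_of_nonneg _ _ (by linarith : 0 ≤ q.toReal), ENNReal.tsum_mul_left]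
    rw [ENNReal.mul_rpow_of_nonneg _ _ (by positivity), ← ENNReal.rpow_mul, mul_one_div_cancel h0,
      ENNReal.rpow_one]

theorem seqNorm_zero {q : ℝ≥0∞} (hq : 1 ≤ q) : seqNorm q (fun _ => 0) = 0 := by
  simpa using seqNorm_const_mul hq 0 (fun _ => 0)

theorem seqNorm_shift_le {q : ℝ≥0∞} (i : ℕ) (a : ℕ → ℝ≥0∞) :
    seqNorm q (fun k => a (k + i)) ≤ seqNorm q a := by
  unfold seqNorm
  split_ifs with h
  · exact iSup_le fun k => le_iSup a (k + i)
  · gcongr ?_ ^ _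
    exact ENNReal.tsum_comp_le_tsum_of_injective (add_left_injective i) (fun k => a k ^ q.toReal)

theorem seqNorm_sum_le {q : ℝ≥0∞} (hq : 1 ≤ q) (n : ℕ) (a : ℕ → ℕ → ℝ≥0∞) :
    seqNorm q (fun k => ∑ i ∈ Finset.range n, a i k) ≤ ∑ i ∈ Finset.range n, seqNorm q (a i) := by
  induction n with
  | zero => simp [seqNorm_zero hq]
  | succ n ih =>
    simp only [Finset.sum_range_succ]
    exact (seqNorm_add_le hq _ _).trans (by gcongr)

/-- Young's inequality for a truncated geometric kernel. -/
theorem seqNorm_geometric_le {q : ℝ≥0∞} (hq : 1 ≤ q) (n : ℕ) (r : ℝ≥0∞) (a : ℕ → ℝ≥0∞) :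
    seqNorm q (fun k => ∑ i ∈ Finset.range n, r ^ i * a (k + i)) ≤ (1 - r)⁻¹ * seqNorm q a := by
  calc _ ≤ ∑ i ∈ Finset.range n, seqNorm q (fun k => r ^ i * a (k + i)) := seqNorm_sum_le hq n _
    _ ≤ ∑ i ∈ Finset.range n, r ^ i * seqNorm q a := by
        gcongr with i _
        rw [seqNorm_const_mul hq]
        gcongr
        exact seqNorm_shift_le i a
    _ = (∑ i ∈ Finset.range n, r ^ i) * seqNorm q a := by rw [Finset.sum_mul]
    _ ≤ _ := by
        gcongr
        rw [← ENNReal.tsum_geometric]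
        exact ENNReal.sum_le_tsum _

variable {I : Type*} [MeasurableSpace I] {m : Measure I}

/-! ### Step functions, increments and averages: definitions. -/

/-- The step function with value `v Q` on each set `Q` of level `k`. -/
noncomputable def Grid.step (𝓖 : Grid m) (k : ℕ) (v : Set I → ℂ) : I → ℂ :=
  fun x => ∑ Q ∈ 𝓖.sets k, Q.indicator (fun _ => v Q) x

open Classical in
/-- A set of level `k` that contains `Q`. -/
noncomputable def Grid.parent (𝓖 : Grid m) (k : ℕ) (Q : Set I) : Set I :=
  if h : ∃ P ∈ 𝓖.sets k, Q ⊆ P then h.choose else ∅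

/-- The increments of a function on the grid from each set to its parent. -/
noncomputable def Grid.incr (𝓖 : Grid m) (v : Set I → ℂ) : ℕ → Set I → ℂ
  | 0, Q => v Q
  | k + 1, Q => v Q - v (𝓖.parent k Q)

/-- The `ℓ^p` norm of the values on level `k`. -/
noncomputable def Grid.levelNorm (𝓖 : Grid m) (p : ℝ) (k : ℕ) (w : Set I → ℝ≥0∞) : ℝ≥0∞ :=
  (∑ Q ∈ 𝓖.sets k, w Q ^ p) ^ (1 / p)

/-- The cost of the representation built from the increments of `v`. -/
noncomputable def Grid.incrNorm (𝓖 : Grid m) (s p : ℝ) (q : ℝ≥0∞) (v : Set I → ℂ) : ℝ≥0∞ :=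
  seqNorm q fun k => 𝓖.levelNorm p k fun Q => m Q ^ (1 / p - s) * ‖𝓖.incr v k Q‖ₑ

/-- The average of `f` over `Q`. -/
noncomputable def avg (m : Measure I) (f : I → ℂ) (Q : Set I) : ℂ := ⨍ x in Q, f x ∂m

variable {𝓖 : Grid m} {c₁ c₂ s p : ℝ} {q : ℝ≥0∞} {k j : ℕ} {P Q R : Set I} {f g : I → ℂ}

/-! ### Norms on a single level. -/

theorem Grid.levelNorm_mono (hp : 1 ≤ p) {w w' : Set I → ℝ≥0∞} (h : ∀ Q ∈ 𝓖.sets k, w Q ≤ w' Q) :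
    𝓖.levelNorm p k w ≤ 𝓖.levelNorm p k w' := by
  have hp0 : 0 ≤ p := zero_le_one.trans hp
  exact ENNReal.rpow_le_rpow (Finset.sum_le_sum fun Q hQ => ENNReal.rpow_le_rpow (h Q hQ) hp0)
    (by positivity)

theorem Grid.levelNorm_add_le (hp : 1 ≤ p) (w w' : Set I → ℝ≥0∞) :
    𝓖.levelNorm p k (fun Q => w Q + w' Q) ≤ 𝓖.levelNorm p k w + 𝓖.levelNorm p k w' :=
  ENNReal.Lp_add_le _ _ _ hp

theorem Grid.levelNorm_const_mul (hp : 1 ≤ p) (C : ℝ≥0∞) (w : Set I → ℝ≥0∞) :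
    𝓖.levelNorm p k (fun Q => C * w Q) = C * 𝓖.levelNorm p k w := by
  have h0 : p ≠ 0 := by linarith
  unfold levelNorm
  simp_rw [ENNReal.mul_rpow_of_nonneg _ _ (by linarith : 0 ≤ p), ← Finset.mul_sum]
  rw [ENNReal.mul_rpow_of_nonneg _ _ (by positivity), ← ENNReal.rpow_mul, mul_one_div_cancel h0,
    ENNReal.rpow_one]

theorem Grid.levelNorm_zero (hp : 1 ≤ p) : 𝓖.levelNorm p k (fun _ => 0) = 0 := by
  simpa using 𝓖.levelNorm_const_mul (k := k) hp 0 (fun _ => 0)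

theorem Grid.levelNorm_sum_le (hp : 1 ≤ p) (n : ℕ) (w : ℕ → Set I → ℝ≥0∞) :
    𝓖.levelNorm p k (fun Q => ∑ i ∈ Finset.range n, w i Q) ≤
      ∑ i ∈ Finset.range n, 𝓖.levelNorm p k (w i) := by
  induction n with
  | zero => simp [levelNorm_zero hp]
  | succ n ih =>
    simp only [Finset.sum_range_succ]
    exact (𝓖.levelNorm_add_le hp _ _).trans (by gcongr)

theorem Grid.levelNorm_rpow (hp : 1 ≤ p) (w : Set I → ℝ≥0∞) :
    𝓖.levelNorm p k w ^ p = ∑ Q ∈ 𝓖.sets k, w Q ^ p := by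
  unfold levelNorm
  rw [← ENNReal.rpow_mul, one_div_mul_cancel (by linarith), ENNReal.rpow_one]

theorem Grid.cost_eq (c : Set I → ℂ) :
    𝓖.cost p q c = seqNorm q fun k => 𝓖.levelNorm p k fun Q => ‖c Q‖ₑ := by
  unfold cost seqNorm levelNorm
  split_ifs
  · rfl
  · simp_rw [← ENNReal.rpow_mul, one_div_mul_eq_div]

/-! ### Nesting of the grid and norms of step functions. -/

theorem Grid.eq_of_inter_nonempty (h𝓖 : 𝓖.IsGood c₁ c₂) (hP : P ∈ 𝓖.sets k) (hQ : Q ∈ 𝓖.sets k)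
    (h : (P ∩ Q).Nonempty) : P = Q := by
  by_contra hne
  exact Set.not_disjoint_iff_nonempty_inter.2 h (h𝓖.disjoint k P hP Q hQ hne)

theorem Grid.nonempty_of_mem (hQ : Q ∈ 𝓖.sets k) : Q.Nonempty :=
  nonempty_of_measure_ne_zero (𝓖.measure_pos k Q hQ).ne'

theorem Grid.exists_ancestor (h𝓖 : 𝓖.IsGood c₁ c₂) (hjk : j ≤ k) (hQ : Q ∈ 𝓖.sets k) :
    ∃ P ∈ 𝓖.sets j, Q ⊆ P := by
  induction k, hjk using Nat.le_induction generalizing Q with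
  | base => exact ⟨Q, hQ, subset_rfl⟩
  | succ k _ ih =>
    obtain ⟨R, hR, hQR⟩ := h𝓖.nested k Q hQ
    obtain ⟨P, hP, hRP⟩ := ih hR
    exact ⟨P, hP, hQR.trans hRP⟩

/-- The level-`j` ancestor of `Q` meets `P`, hence is `P` by disjointness: sets of the grid are
nested or disjoint. -/
theorem Grid.subset_of_inter_nonempty (h𝓖 : 𝓖.IsGood c₁ c₂) (hjk : j ≤ k) (hQ : Q ∈ 𝓖.sets k)
    (hP : P ∈ 𝓖.sets j) (h : (Q ∩ P).Nonempty) : Q ⊆ P := by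
  obtain ⟨R, hR, hQR⟩ := exists_ancestor h𝓖 hjk hQ
  rwa [← eq_of_inter_nonempty h𝓖 hR hP (h.mono (Set.inter_subset_inter_left _ hQR))]

theorem Grid.parent_spec (h𝓖 : 𝓖.IsGood c₁ c₂) (hQ : Q ∈ 𝓖.sets (k + 1)) :
    𝓖.parent k Q ∈ 𝓖.sets k ∧ Q ⊆ 𝓖.parent k Q := by
  have h := h𝓖.nested k Q hQ
  rw [parent, dif_pos h]
  exact h.choose_spec

theorem Grid.step_apply (h𝓖 : 𝓖.IsGood c₁ c₂) (v : Set I → ℂ) (hQ : Q ∈ 𝓖.sets k) {x : I}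
    (hx : x ∈ Q) : 𝓖.step k v x = v Q := by
  unfold step
  rw [Finset.sum_eq_single_of_mem Q hQ, Set.indicator_of_mem hx]
  intro P hP hne
  refine Set.indicator_of_notMem (fun hxP => hne ?_) _
  exact eq_of_inter_nonempty h𝓖 hP hQ ⟨x, hxP, hx⟩

theorem Grid.stronglyMeasurable_step (k : ℕ) (v : Set I → ℂ) :
    StronglyMeasurable (𝓖.step k v) := by
  unfold step
  exact Finset.stronglyMeasurable_fun_sum _ fun Q hQ =>
    stronglyMeasurable_const.indicator (𝓖.measurableSet k Q hQ)

theorem Grid.ae_mem (h𝓖 : 𝓖.IsGood c₁ c₂) (k : ℕ) : ∀ᵐ x ∂m, ∃ Q ∈ 𝓖.sets k, x ∈ Q := by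
  filter_upwards [compl_mem_ae_iff.2 (h𝓖.cover k)] with x hx
  simpa using hx

/-- Disjointness of a level decouples the values. The measure is arbitrary so that restrictions of
`m` to sets of a coarser level are covered. -/
theorem Grid.eLpNorm_step_rpow (h𝓖 : 𝓖.IsGood c₁ c₂) (hp : 1 ≤ p) (μ : Measure I)
    (v : Set I → ℂ) :
    eLpNorm (𝓖.step k v) (ENNReal.ofReal p) μ ^ p = ∑ Q ∈ 𝓖.sets k, ‖v Q‖ₑ ^ p * μ Q := by
  have hp0 : 0 < p := by linarith
  rw [eLpNorm_eq_lintegral_rpow_enorm_toReal (by simpa using hp0) ENNReal.ofReal_ne_top,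
    ENNReal.toReal_ofReal hp0.le, ← ENNReal.rpow_mul, one_div_mul_cancel hp0.ne', ENNReal.rpow_one]
  have : ∀ x, ‖𝓖.step k v x‖ₑ ^ p = ∑ Q ∈ 𝓖.sets k, Q.indicator (fun _ => ‖v Q‖ₑ ^ p) x := by
    intro x
    by_cases hx : ∃ Q ∈ 𝓖.sets k, x ∈ Q
    · obtain ⟨Q, hQ, hxQ⟩ := hx
      rw [step_apply h𝓖 v hQ hxQ, Finset.sum_eq_single_of_mem Q hQ, Set.indicator_of_mem hxQ]
      intro P hP hne
      refine Set.indicator_of_notMem (fun hxP => hne ?_) _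
      exact eq_of_inter_nonempty h𝓖 hP hQ ⟨x, hxP, hxQ⟩
    · push Not at hx
      rw [step, Finset.sum_eq_zero fun Q hQ => Set.indicator_of_notMem (hx Q hQ) _,
        Finset.sum_eq_zero fun Q hQ => Set.indicator_of_notMem (hx Q hQ) _]
      simp [hp0]
  simp_rw [this]
  rw [lintegral_finsetSum _ fun Q hQ => measurable_const.indicator (𝓖.measurableSet k Q hQ)]
  refine Finset.sum_congr rfl fun Q hQ => ?_
  rw [lintegral_indicator (𝓖.measurableSet k Q hQ), setLIntegral_const]

theorem Grid.memLp_step [IsFiniteMeasure m] (k : ℕ) (v : Set I → ℂ) (r : ℝ≥0∞) :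
    MemLp (𝓖.step k v) r m := by
  unfold step
  exact memLp_finsetSum _ fun Q hQ =>
    (memLp_const (v Q)).indicator (𝓖.measurableSet k Q hQ)

/-! ### Averages over sets of the grid. -/

/-- Jensen's inequality for averages. -/
theorem enorm_avg_mul_le [IsFiniteMeasure m] (hp : 1 ≤ p) (hf : AEStronglyMeasurable f m)
    (hQ : m Q ≠ 0) :
    m Q ^ (1 / p) * ‖avg m f Q‖ₑ ≤ eLpNorm f (ENNReal.ofReal p) (m.restrict Q) := by
  have hT : m Q ≠ ∞ := measure_ne_top m Q
  have h1 : ‖avg m f Q‖ₑ ≤ (m Q)⁻¹ * eLpNorm f 1 (m.restrict Q) := by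
    rw [avg, setAverage_eq, enorm_smul, eLpNorm_one_eq_lintegral_enorm]
    gcongr
    · rw [enorm_inv (by simpa [measureReal_eq_zero_iff] using hQ), measureReal_def,
        Real.enorm_eq_ofReal ENNReal.toReal_nonneg, ENNReal.ofReal_toReal hT]
    · exact enorm_integral_le_lintegral_enorm _
  have h2 := eLpNorm_le_eLpNorm_mul_rpow_measure_univ (μ := m.restrict Q) (p := 1)
    (q := ENNReal.ofReal p) (f := f) (by simpa using hp) hf.restrict
  rw [Measure.restrict_apply_univ, ENNReal.toReal_ofReal (by linarith), ENNReal.toReal_one] at h2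
  calc _ ≤ m Q ^ (1 / p) * ((m Q)⁻¹ * (eLpNorm f (ENNReal.ofReal p) (m.restrict Q) *
        m Q ^ (1 / 1 - 1 / p))) := by gcongr; exact h1.trans (by gcongr)
    _ = (m Q ^ (1 / p) * m Q ^ (1 / 1 - 1 / p) * (m Q)⁻¹) *
        eLpNorm f (ENNReal.ofReal p) (m.restrict Q) := by ring
    _ = _ := by
        rw [← ENNReal.rpow_add _ _ hQ hT]
        simp [ENNReal.mul_inv_cancel hQ hT]

theorem avg_of_const [IsFiniteMeasure m] (hmQ : MeasurableSet Q) (hQ : m Q ≠ 0) {z : ℂ}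
    (h : ∀ x ∈ Q, f x = z) :
    avg m f Q = z := by
  rw [avg, setAverage_congr_fun hmQ (Eventually.of_forall h), setAverage_const hQ (measure_ne_top m Q)]

theorem avg_add (hf : Integrable f m) (hg : Integrable g m) (Q : Set I) :
    avg m (f + g) Q = avg m f Q + avg m g Q := by
  simp only [avg, setAverage_eq, Pi.add_apply]
  rw [integral_add hf.integrableOn hg.integrableOn, smul_add]

theorem avg_sub (hf : Integrable f m) (hg : Integrable g m) (Q : Set I) :
    avg m (f - g) Q = avg m f Q - avg m g Q := by
  simp only [avg, setAverage_eq, Pi.sub_apply]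
  rw [integral_sub hf.integrableOn hg.integrableOn, smul_sub]

theorem enorm_avg_le_top [IsFiniteMeasure m] (hQ : m Q ≠ 0) :
    ‖avg m f Q‖ₑ ≤ eLpNorm f ∞ m := by
  have hT : m Q ≠ ∞ := measure_ne_top m Q
  rw [avg, setAverage_eq, enorm_smul, enorm_inv (by simpa [measureReal_eq_zero_iff] using hQ),
    measureReal_def, Real.enorm_eq_ofReal ENNReal.toReal_nonneg, ENNReal.ofReal_toReal hT,
    mul_comm, ← div_eq_mul_inv]
  refine ENNReal.div_le_of_le_mul ?_
  refine (enorm_integral_le_lintegral_enorm _).trans ?_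
  calc ∫⁻ x in Q, ‖f x‖ₑ ∂m ≤ ∫⁻ _ in Q, eLpNorm f ∞ m ∂m := by
        refine lintegral_mono_ae (ae_restrict_of_ae ?_)
        simpa using ae_le_eLpNormEssSup (f := f) (μ := m)
    _ = _ := by rw [setLIntegral_const]

theorem Grid.sum_eLpNorm_restrict_le (h𝓖 : 𝓖.IsGood c₁ c₂) (hp : 1 ≤ p) (k : ℕ) (f : I → ℂ) :
    ∑ Q ∈ 𝓖.sets k, eLpNorm f (ENNReal.ofReal p) (m.restrict Q) ^ p ≤
      eLpNorm f (ENNReal.ofReal p) m ^ p := by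
  have hp0 : 0 < p := by linarith
  have key : ∀ μ : Measure I, eLpNorm f (ENNReal.ofReal p) μ ^ p = ∫⁻ x, ‖f x‖ₑ ^ p ∂μ := by
    intro μ
    rw [eLpNorm_eq_lintegral_rpow_enorm_toReal (by simpa using hp0) ENNReal.ofReal_ne_top,
      ENNReal.toReal_ofReal hp0.le, ← ENNReal.rpow_mul, one_div_mul_cancel hp0.ne',
      ENNReal.rpow_one]
  simp_rw [key]
  rw [← lintegral_biUnion_finset (fun P hP Q hQ hne => h𝓖.disjoint k P hP Q hQ hne)
    (𝓖.measurableSet k)]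
  exact setLIntegral_le_lintegral _ _

/-- Averaging over a level is a contraction of `L^p`: Jensen on each set, then summation over
disjoint sets. -/
theorem Grid.eLpNorm_step_avg_le [IsFiniteMeasure m] (h𝓖 : 𝓖.IsGood c₁ c₂) (hp : 1 ≤ p) (k : ℕ)
    (hf : AEStronglyMeasurable f m) :
    eLpNorm (𝓖.step k (avg m f)) (ENNReal.ofReal p) m ≤ eLpNorm f (ENNReal.ofReal p) m := by
  have hp0 : 0 < p := by linarith
  rw [← ENNReal.rpow_le_rpow_iff hp0, eLpNorm_step_rpow h𝓖 hp]
  refine le_trans (Finset.sum_le_sum fun Q hQ => ?_) (sum_eLpNorm_restrict_le h𝓖 hp k f)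
  calc ‖avg m f Q‖ₑ ^ p * m Q = (m Q ^ (1 / p) * ‖avg m f Q‖ₑ) ^ p := by
        rw [ENNReal.mul_rpow_of_nonneg _ _ hp0.le, ← ENNReal.rpow_mul,
          one_div_mul_cancel hp0.ne', ENNReal.rpow_one, mul_comm]
    _ ≤ _ := by
        gcongr
        exact enorm_avg_mul_le hp hf (𝓖.measure_pos k Q hQ).ne'

theorem Grid.step_avg_ae_eq [IsFiniteMeasure m] (h𝓖 : 𝓖.IsGood c₁ c₂) (k : ℕ)
    (h : ∀ Q ∈ 𝓖.sets k, ∃ z, ∀ x ∈ Q, f x = z) : 𝓖.step k (avg m f) =ᵐ[m] f := by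
  filter_upwards [ae_mem h𝓖 k] with x ⟨Q, hQ, hx⟩
  obtain ⟨z, hz⟩ := h Q hQ
  rw [step_apply h𝓖 _ hQ hx, hz x hx,
    avg_of_const (𝓖.measurableSet k Q hQ) (𝓖.measure_pos k Q hQ).ne' hz]

theorem Grid.step_avg_sub (𝓖 : Grid m) (k : ℕ) (hf : Integrable f m) (hg : Integrable g m) :
    𝓖.step k (avg m (f - g)) = 𝓖.step k (avg m f) - 𝓖.step k (avg m g) := by
  ext x
  simp only [step, avg_sub hf hg, Pi.sub_apply, ← Finset.sum_sub_distrib]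
  refine Finset.sum_congr rfl fun Q _ => ?_
  by_cases hx : x ∈ Q <;> simp [hx]

/-! ### Convergence of averages. -/

/-- The averages of `f` over the levels of the grid converge to `f` in `L^p`. -/
def Grid.AvgConv (𝓖 : Grid m) (p : ℝ) (f : I → ℂ) : Prop :=
  Tendsto (fun k => eLpNorm (f - 𝓖.step k (avg m f)) (ENNReal.ofReal p) m) atTop (𝓝 0)

/-- An `ε/3` argument: since averaging is linear and an `L^p` contraction, convergence of averages
is closed under `L^p` limits. This avoids martingale convergence, as Besov functions are `L^p`
limits of step functions. -/
theorem Grid.AvgConv.of_approx [IsFiniteMeasure m] (h𝓖 : 𝓖.IsGood c₁ c₂) (hp : 1 ≤ p)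
    (hf : MemLp f (ENNReal.ofReal p) m) {F : ℕ → I → ℂ}
    (hF : ∀ n, MemLp (F n) (ENNReal.ofReal p) m) (hc : ∀ n, 𝓖.AvgConv p (F n))
    (hlim : Tendsto (fun n => eLpNorm (f - F n) (ENNReal.ofReal p) m) atTop (𝓝 0)) :
    𝓖.AvgConv p f := by
  have h1 : (1 : ℝ≥0∞) ≤ ENNReal.ofReal p := by simpa using hp
  rw [AvgConv, ENNReal.tendsto_nhds_zero]
  intro ε hε
  have hε3 : 0 < ε / 3 := by simp [hε.ne']
  obtain ⟨n, hn⟩ := ((ENNReal.tendsto_nhds_zero.1 hlim) _ hε3).exists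
  filter_upwards [(ENNReal.tendsto_nhds_zero.1 (hc n)) _ hε3] with k hk
  have hfF := (hf.sub (hF n)).aestronglyMeasurable
  have hst : ∀ v, AEStronglyMeasurable (𝓖.step k v) m := fun v =>
    (stronglyMeasurable_step k v).aestronglyMeasurable
  have e : f - 𝓖.step k (avg m f) = ((f - F n) + (F n - 𝓖.step k (avg m (F n)))) -
      𝓖.step k (avg m (f - F n)) := by
    rw [𝓖.step_avg_sub k (hf.integrable h1) ((hF n).integrable h1)]
    abel
  rw [e]
  calc _ ≤ eLpNorm ((f - F n) + (F n - 𝓖.step k (avg m (F n)))) (ENNReal.ofReal p) m +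
        eLpNorm (𝓖.step k (avg m (f - F n))) (ENNReal.ofReal p) m :=
        eLpNorm_sub_le (hfF.add ((hF n).aestronglyMeasurable.sub (hst _))) (hst _) h1
    _ ≤ (eLpNorm (f - F n) (ENNReal.ofReal p) m +
        eLpNorm (F n - 𝓖.step k (avg m (F n))) (ENNReal.ofReal p) m) +
        eLpNorm (f - F n) (ENNReal.ofReal p) m :=
        add_le_add (eLpNorm_add_le hfF ((hF n).aestronglyMeasurable.sub (hst _)) h1)
          (eLpNorm_step_avg_le h𝓖 hp k hfF)
    _ ≤ ε / 3 + ε / 3 + ε / 3 := by gcongr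
    _ = ε := ENNReal.add_thirds ε

theorem Grid.AvgConv.of_const [IsFiniteMeasure m] (h𝓖 : 𝓖.IsGood c₁ c₂) (n : ℕ)
    (h : ∀ k ≥ n, ∀ Q ∈ 𝓖.sets k, ∃ z, ∀ x ∈ Q, f x = z) : 𝓖.AvgConv p f := by
  refine tendsto_const_nhds.congr' ?_
  filter_upwards [eventually_ge_atTop n] with k hk
  have h0 : f - 𝓖.step k (avg m f) =ᵐ[m] 0 := by
    filter_upwards [step_avg_ae_eq h𝓖 k (h k hk)] with x hx
    simp [hx]
  rw [eLpNorm_congr_ae h0, eLpNorm_zero]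

/-- For fixed `Q`, averaging over `Q` is a continuous functional on `L^p`, with norm at most
`|Q|^{-1/p}` by Jensen. -/
theorem tendsto_avg [IsFiniteMeasure m] (hp : 1 ≤ p)
    (hf : MemLp f (ENNReal.ofReal p) m) {F : ℕ → I → ℂ}
    (hF : ∀ n, MemLp (F n) (ENNReal.ofReal p) m)
    (hlim : Tendsto (fun n => eLpNorm (f - F n) (ENNReal.ofReal p) m) atTop (𝓝 0))
    (hQ : m Q ≠ 0) : Tendsto (fun n => avg m (F n) Q) atTop (𝓝 (avg m f Q)) := by
  have h1 : (1 : ℝ≥0∞) ≤ ENNReal.ofReal p := by simpa using hp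
  have hT : m Q ≠ ∞ := measure_ne_top m Q
  rw [tendsto_iff_edist_tendsto_0]
  have hlim' := ENNReal.Tendsto.const_mul (a := m Q ^ (-(1 / p))) hlim
    (Or.inr (ENNReal.rpow_ne_top_of_ne_zero hQ hT))
  rw [mul_zero] at hlim'
  refine tendsto_of_tendsto_of_tendsto_of_le_of_le tendsto_const_nhds hlim' (fun _ => zero_le)
    fun n => ?_
  have := (enorm_avg_mul_le hp (hf.sub (hF n)).aestronglyMeasurable hQ).trans
    (eLpNorm_mono_measure _ Measure.restrict_le_self)
  rw [edist_comm, edist_eq_enorm_sub, ← avg_sub (hf.integrable h1) ((hF n).integrable h1)]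
  calc _ = m Q ^ (-(1 / p)) * (m Q ^ (1 / p) * ‖avg m (f - F n) Q‖ₑ) := by
        rw [← mul_assoc, ← ENNReal.rpow_add _ _ hQ hT]; simp
    _ ≤ _ := by gcongr

theorem Grid.tendsto_levelNorm {w : ℕ → Set I → ℝ≥0∞} {w' : Set I → ℝ≥0∞}
    (h : ∀ Q ∈ 𝓖.sets k, Tendsto (fun n => w n Q) atTop (𝓝 (w' Q))) :
    Tendsto (fun n => 𝓖.levelNorm p k (w n)) atTop (𝓝 (𝓖.levelNorm p k w')) := by
  refine (ENNReal.continuous_rpow_const.tendsto _).comp ?_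
  exact tendsto_finsetSum _ fun Q hQ => (ENNReal.continuous_rpow_const.tendsto _).comp (h Q hQ)

/-- Lower semicontinuity: each level involves finitely many values, so its norm passes to the limit,
and Fatou handles the sum over levels. It serves both for partial sums of a representation and for
Cauchy sequences. -/
theorem Grid.incrNorm_le_of_tendsto [IsFiniteMeasure m] (h𝓖 : 𝓖.IsGood c₁ c₂) (hq : 1 ≤ q)
    {v : ℕ → Set I → ℂ} {w : Set I → ℂ} {C : ℝ≥0∞}
    (h : ∀ k, ∀ Q ∈ 𝓖.sets k, Tendsto (fun n => v n Q) atTop (𝓝 (w Q)))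
    (hC : ∀ᶠ n in atTop, 𝓖.incrNorm s p q (v n) ≤ C) : 𝓖.incrNorm s p q w ≤ C := by
  refine seqNorm_le_of_tendsto hq (fun k => ?_) hC
  refine tendsto_levelNorm fun Q hQ => ?_
  refine ENNReal.Tendsto.const_mul ?_ (Or.inr (ENNReal.rpow_ne_top_of_ne_zero
    (𝓖.measure_pos k Q hQ).ne' (measure_ne_top m Q)))
  refine (continuous_enorm.tendsto _).comp ?_
  cases k with
  | zero => exact h 0 Q hQ
  | succ k => exact (h _ Q hQ).sub (h k _ (parent_spec h𝓖 hQ).1)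

/-! ### Measures of nested sets -/

theorem Grid.measure_child_le [IsFiniteMeasure m] (h𝓖 : 𝓖.IsGood c₁ c₂) (hQ : Q ∈ 𝓖.sets (k + 1))
    (hP : P ∈ 𝓖.sets k) (h : Q ⊆ P) : m Q ≤ ENNReal.ofReal c₂ * m P := by
  have h0 : 0 < m.real P := ENNReal.toReal_pos (𝓖.measure_pos k P hP).ne' (measure_ne_top m P)
  have := (h𝓖.ratio k Q hQ P hP h).2
  rw [div_le_iff₀ h0] at this
  rw [← ofReal_measureReal (s := Q), ← ofReal_measureReal (s := P),
    ← ENNReal.ofReal_mul (h𝓖.pos.trans h𝓖.lt).le]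
  exact ENNReal.ofReal_le_ofReal this

theorem Grid.le_measure_child [IsFiniteMeasure m] (h𝓖 : 𝓖.IsGood c₁ c₂) (hQ : Q ∈ 𝓖.sets (k + 1))
    (hP : P ∈ 𝓖.sets k) (h : Q ⊆ P) : ENNReal.ofReal c₁ * m P ≤ m Q := by
  have h0 : 0 < m.real P := ENNReal.toReal_pos (𝓖.measure_pos k P hP).ne' (measure_ne_top m P)
  have := (h𝓖.ratio k Q hQ P hP h).1
  rw [le_div_iff₀ h0] at this
  rw [← ofReal_measureReal (s := Q), ← ofReal_measureReal (s := P),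
    ← ENNReal.ofReal_mul h𝓖.pos.le]
  exact ENNReal.ofReal_le_ofReal this

theorem Grid.measure_descendant_le [IsFiniteMeasure m] (h𝓖 : 𝓖.IsGood c₁ c₂) (hkj : k ≤ j)
    (hR : R ∈ 𝓖.sets j) (hQ : Q ∈ 𝓖.sets k) (h : R ⊆ Q) :
    m R ≤ ENNReal.ofReal c₂ ^ (j - k) * m Q := by
  induction j, hkj using Nat.le_induction generalizing R with
  | base => simpa using measure_mono h
  | succ j hkj ih =>
    obtain ⟨P, hP, hRP⟩ := h𝓖.nested j R hR
    have hPQ : P ⊆ Q := by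
      refine subset_of_inter_nonempty h𝓖 hkj hP hQ ?_
      exact (nonempty_of_mem hR).mono (Set.subset_inter hRP h)
    calc m R ≤ ENNReal.ofReal c₂ * m P := measure_child_le h𝓖 hR hP hRP
      _ ≤ ENNReal.ofReal c₂ * (ENNReal.ofReal c₂ ^ (j - k) * m Q) := by gcongr; exact ih hP hPQ
      _ = _ := by rw [Nat.succ_sub hkj, pow_succ]; ring

theorem Grid.measure_rpow_descendant_le [IsFiniteMeasure m] (h𝓖 : 𝓖.IsGood c₁ c₂) (hs : 0 < s)
    (hkj : k ≤ j) (hR : R ∈ 𝓖.sets j) (hQ : Q ∈ 𝓖.sets k) (h : R ⊆ Q) :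
    m R ^ s ≤ ENNReal.ofReal (c₂ ^ s) ^ (j - k) * m Q ^ s := by
  calc m R ^ s ≤ (ENNReal.ofReal c₂ ^ (j - k) * m Q) ^ s := by
        gcongr
        exact measure_descendant_le h𝓖 hkj hR hQ h
    _ = _ := by
        rw [ENNReal.mul_rpow_of_nonneg _ _ hs.le,
          ← ENNReal.ofReal_rpow_of_pos (h𝓖.pos.trans h𝓖.lt), ← ENNReal.rpow_natCast,
          ← ENNReal.rpow_natCast, ← ENNReal.rpow_mul, ← ENNReal.rpow_mul, mul_comm s]

theorem Grid.measure_rpow_le [IsFiniteMeasure m] (h𝓖 : 𝓖.IsGood c₁ c₂) (hs : 0 < s)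
    (hQ : Q ∈ 𝓖.sets k) : m Q ^ s ≤ ENNReal.ofReal (c₂ ^ s) ^ k * m Set.univ ^ s := by
  have := measure_rpow_descendant_le h𝓖 hs (Nat.zero_le k) hQ (Q := Set.univ)
    (by simp [h𝓖.level_zero]) (Set.subset_univ Q)
  simpa using this

theorem Grid.ratio_rpow_lt_one (h𝓖 : 𝓖.IsGood c₁ c₂) (hs : 0 < s) :
    ENNReal.ofReal (c₂ ^ s) < 1 := by
  rw [ENNReal.ofReal_lt_one]
  exact Real.rpow_lt_one (h𝓖.pos.trans h𝓖.lt).le h𝓖.lt_one hs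

/-! ### Increments of a step function -/

/-- The source of the decay. On `Q` the `L^p` norm of the step function is an `ℓ^p` sum over the `R
⊆ Q` of level `j`, with terms of size `b R * |R|^s`, and `|R|^s ≤ (c₂^s)^(j-k) |Q|^s`. Each `R` lies
in exactly one `Q`, so summing over `Q` counts it once. -/
theorem Grid.levelNorm_local_step_le [IsFiniteMeasure m] (h𝓖 : 𝓖.IsGood c₁ c₂) (hs : 0 < s)
    (hp : 1 ≤ p) (hkj : k ≤ j) {y : Set I → ℂ} {b : Set I → ℝ≥0∞}
    (hy : ∀ R ∈ 𝓖.sets j, ‖y R‖ₑ ≤ b R * m R ^ (s - 1 / p)) :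
    𝓖.levelNorm p k (fun Q => m Q ^ (-s) *
      eLpNorm (𝓖.step j y) (ENNReal.ofReal p) (m.restrict Q)) ≤
      ENNReal.ofReal (c₂ ^ s) ^ (j - k) * 𝓖.levelNorm p j b := by
  have hp0 : 0 < p := by linarith
  set r := ENNReal.ofReal (c₂ ^ s)
  rw [← ENNReal.rpow_le_rpow_iff hp0, ENNReal.mul_rpow_of_nonneg _ _ hp0.le, levelNorm_rpow hp,
    levelNorm_rpow hp, Finset.mul_sum]
  classical
  calc _ ≤ ∑ Q ∈ 𝓖.sets k, ∑ R ∈ 𝓖.sets j, if R ⊆ Q then (r ^ (j - k)) ^ p * b R ^ p else 0 := by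
        refine Finset.sum_le_sum fun Q hQ => ?_
        rw [ENNReal.mul_rpow_of_nonneg _ _ hp0.le, eLpNorm_step_rpow h𝓖 hp, Finset.mul_sum]
        refine Finset.sum_le_sum fun R hR => ?_
        have hR0 : m R ≠ 0 := (𝓖.measure_pos j R hR).ne'
        have hQ0 : m Q ≠ 0 := (𝓖.measure_pos k Q hQ).ne'
        have hRT : m R ≠ ∞ := measure_ne_top m R
        have hQT : m Q ≠ ∞ := measure_ne_top m Q
        rw [Measure.restrict_apply (𝓖.measurableSet j R hR)]
        split_ifs with hRQ
        · rw [Set.inter_eq_left.2 hRQ]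
          calc (m Q ^ (-s)) ^ p * (‖y R‖ₑ ^ p * m R)
              ≤ (m Q ^ (-s)) ^ p * ((b R * m R ^ (s - 1 / p)) ^ p * m R) := by
                gcongr
                exact hy R hR
            _ = (m Q ^ (-s) * (b R * m R ^ s)) ^ p := by
                have : m R = (m R ^ (1 / p)) ^ p := by
                  rw [← ENNReal.rpow_mul, one_div_mul_cancel hp0.ne', ENNReal.rpow_one]
                nth_rw 2 [this]
                rw [← ENNReal.mul_rpow_of_nonneg _ _ hp0.le, ← ENNReal.mul_rpow_of_nonneg _ _ hp0.le,
                  mul_assoc (b R), ← ENNReal.rpow_add _ _ hR0 hRT, sub_add_cancel]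
            _ ≤ (m Q ^ (-s) * (b R * (r ^ (j - k) * m Q ^ s))) ^ p := by
                gcongr
                exact measure_rpow_descendant_le h𝓖 hs hkj hR hQ hRQ
            _ = ((m Q ^ (-s) * m Q ^ s) * (r ^ (j - k) * b R)) ^ p := by ring_nf
            _ = _ := by
                rw [← ENNReal.rpow_add _ _ hQ0 hQT, neg_add_cancel, ENNReal.rpow_zero, one_mul,
                  ENNReal.mul_rpow_of_nonneg _ _ hp0.le]
        · have : R ∩ Q = ∅ := by
            by_contra hne
            exact hRQ (subset_of_inter_nonempty h𝓖 hkj hR hQ (Set.nonempty_iff_ne_empty.2 hne))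
          simp [this]
    _ ≤ _ := by
        rw [Finset.sum_comm]
        refine Finset.sum_le_sum fun R hR => ?_
        obtain ⟨P, hP, hRP⟩ := exists_ancestor h𝓖 hkj hR
        rw [Finset.sum_eq_single_of_mem P hP]
        · rw [if_pos hRP]
        · intro Q hQ hne
          refine if_neg fun hRQ => hne ?_
          exact eq_of_inter_nonempty h𝓖 hQ hP
            ((nonempty_of_mem hR).mono (Set.subset_inter hRQ hRP))

theorem Grid.levelNorm_avg_le [IsFiniteMeasure m] (hp : 1 ≤ p) (k : ℕ)
    (hf : AEStronglyMeasurable f m) :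
    𝓖.levelNorm p k (fun Q => m Q ^ (1 / p - s) * ‖avg m f Q‖ₑ) ≤
      𝓖.levelNorm p k (fun Q => m Q ^ (-s) * eLpNorm f (ENNReal.ofReal p) (m.restrict Q)) := by
  refine levelNorm_mono hp fun Q hQ => ?_
  have hQ0 : m Q ≠ 0 := (𝓖.measure_pos k Q hQ).ne'
  rw [sub_eq_neg_add, ENNReal.rpow_add _ _ hQ0 (measure_ne_top m Q), mul_assoc]
  gcongr
  exact enorm_avg_mul_le hp hf hQ0

/-- Write `|Q|^{1-sp} = |Q| * (|Q|^{-s})^p`. The second factor is controlled by `|Q| ≥ c₁ |P|`, and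
the measures `|Q|` of the disjoint children of `P` add up to at most `|P|`, so the number of
children does not enter. -/
theorem Grid.levelNorm_parent_le [IsFiniteMeasure m] (h𝓖 : 𝓖.IsGood c₁ c₂) (hs : 0 < s)
    (hp : 1 ≤ p) (k : ℕ) (w : Set I → ℝ≥0∞) :
    𝓖.levelNorm p (k + 1) (fun Q => m Q ^ (1 / p - s) * w (𝓖.parent k Q)) ≤
      ENNReal.ofReal c₁ ^ (-s) * 𝓖.levelNorm p k (fun P => m P ^ (1 / p - s) * w P) := by
  have hp0 : 0 < p := by linarith
  have hc0 : ENNReal.ofReal c₁ ≠ 0 := by simpa using h𝓖.pos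
  rw [← ENNReal.rpow_le_rpow_iff hp0, ENNReal.mul_rpow_of_nonneg _ _ hp0.le, levelNorm_rpow hp,
    levelNorm_rpow hp, Finset.mul_sum]
  classical
  rw [← Finset.sum_fiberwise_of_maps_to (fun Q hQ => (parent_spec h𝓖 hQ).1)]
  refine Finset.sum_le_sum fun P hP => ?_
  have hP0 : m P ≠ 0 := (𝓖.measure_pos k P hP).ne'
  have hPT : m P ≠ ∞ := measure_ne_top m P
  have split : ∀ Q : Set I, m Q ≠ 0 → (m Q ^ (1 / p - s)) ^ p = m Q * (m Q ^ (-s)) ^ p := by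
    intro Q hQ0
    rw [← ENNReal.rpow_mul, ← ENNReal.rpow_mul, sub_mul, one_div_mul_cancel hp0.ne', sub_eq_add_neg,
      ENNReal.rpow_add _ _ hQ0 (measure_ne_top m Q), ENNReal.rpow_one, neg_mul]
  calc _ ≤ ∑ Q ∈ 𝓖.sets (k + 1) with 𝓖.parent k Q = P,
        m Q * (ENNReal.ofReal c₁ ^ (-s) * m P ^ (-s) * w P) ^ p := by
        refine Finset.sum_le_sum fun Q hQ => ?_
        obtain ⟨hQ', rfl⟩ := Finset.mem_filter.1 hQ
        have hQ0 : m Q ≠ 0 := (𝓖.measure_pos _ Q hQ').ne'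
        rw [ENNReal.mul_rpow_of_nonneg _ _ hp0.le, split Q hQ0, mul_assoc,
          ← ENNReal.mul_rpow_of_nonneg _ _ hp0.le]
        gcongr
        rw [← ENNReal.mul_rpow_of_ne_zero hc0 hP0, ENNReal.rpow_neg, ENNReal.rpow_neg]
        gcongr
        exact le_measure_child h𝓖 hQ' hP (parent_spec h𝓖 hQ').2
    _ ≤ m P * (ENNReal.ofReal c₁ ^ (-s) * m P ^ (-s) * w P) ^ p := by
        rw [← Finset.sum_mul]
        gcongr
        rw [← measure_biUnion_finset (f := fun Q => Q)]
        · refine measure_mono (Set.iUnion₂_subset fun Q hQ => ?_)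
          obtain ⟨hQ', rfl⟩ := Finset.mem_filter.1 hQ
          exact (parent_spec h𝓖 hQ').2
        · intro Q hQ R hR hne
          exact h𝓖.disjoint _ Q (Finset.mem_filter.1 hQ).1 R (Finset.mem_filter.1 hR).1 hne
        · exact fun Q hQ => 𝓖.measurableSet _ Q (Finset.mem_filter.1 hQ).1
    _ = _ := by
        rw [ENNReal.mul_rpow_of_nonneg (m P ^ (1 / p - s)) _ hp0.le, split P hP0,
          ENNReal.mul_rpow_of_nonneg _ _ hp0.le, ENNReal.mul_rpow_of_nonneg _ _ hp0.le]
        ring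

theorem Grid.step_const_on (h𝓖 : 𝓖.IsGood c₁ c₂) (hjk : j ≤ k) (hQ : Q ∈ 𝓖.sets k)
    (y : Set I → ℂ) : ∃ z, ∀ x ∈ Q, 𝓖.step j y x = z := by
  obtain ⟨P, hP, hQP⟩ := exists_ancestor h𝓖 hjk hQ
  exact ⟨y P, fun x hx => step_apply h𝓖 y hP (hQP hx)⟩

/-- For `j < k` the parent of `Q` has level at least `j`, so the step function is already constant
on the parent. -/
theorem Grid.incr_avg_step_eq_zero [IsFiniteMeasure m] (h𝓖 : 𝓖.IsGood c₁ c₂) (hjk : j < k)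
    (hQ : Q ∈ 𝓖.sets k) (y : Set I → ℂ) : 𝓖.incr (avg m (𝓖.step j y)) k Q = 0 := by
  obtain _ | k := k
  · omega
  obtain ⟨hP, hQP⟩ := parent_spec h𝓖 hQ
  obtain ⟨z, hz⟩ := step_const_on h𝓖 (Nat.lt_succ_iff.1 hjk) hP y
  rw [incr, avg_of_const (𝓖.measurableSet _ _ hP) (𝓖.measure_pos _ _ hP).ne' hz,
    avg_of_const (𝓖.measurableSet _ _ hQ) (𝓖.measure_pos _ _ hQ).ne' fun x hx => hz x (hQP hx),
    sub_self]

/-- The increment is bounded by the average on `Q` plus the average on its parent. The parent is one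
level up: it gains one more factor `c₂^s` and costs `c₁^{-s}`, hence the constant. -/
theorem Grid.levelNorm_incr_avg_step_le [IsFiniteMeasure m] (h𝓖 : 𝓖.IsGood c₁ c₂) (hs : 0 < s)
    (hp : 1 ≤ p) (hkj : k ≤ j) {y : Set I → ℂ} {b : Set I → ℝ≥0∞}
    (hy : ∀ R ∈ 𝓖.sets j, ‖y R‖ₑ ≤ b R * m R ^ (s - 1 / p)) :
    𝓖.levelNorm p k (fun Q => m Q ^ (1 / p - s) * ‖𝓖.incr (avg m (𝓖.step j y)) k Q‖ₑ) ≤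
      (1 + ENNReal.ofReal c₁ ^ (-s) * ENNReal.ofReal (c₂ ^ s)) *
        (ENNReal.ofReal (c₂ ^ s) ^ (j - k) * 𝓖.levelNorm p j b) := by
  set r := ENNReal.ofReal (c₂ ^ s)
  have hm : AEStronglyMeasurable (𝓖.step j y) m :=
    (stronglyMeasurable_step j y).aestronglyMeasurable
  have base : ∀ k, k ≤ j →
      𝓖.levelNorm p k (fun Q => m Q ^ (1 / p - s) * ‖avg m (𝓖.step j y) Q‖ₑ) ≤
      r ^ (j - k) * 𝓖.levelNorm p j b := fun k hkj =>
    (levelNorm_avg_le hp k hm).trans (levelNorm_local_step_le h𝓖 hs hp hkj hy)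
  obtain _ | k := k
  · refine (base 0 hkj).trans ?_
    rw [add_mul, one_mul]
    exact le_self_add
  · calc _ ≤ 𝓖.levelNorm p (k + 1) (fun Q => m Q ^ (1 / p - s) * ‖avg m (𝓖.step j y) Q‖ₑ +
          m Q ^ (1 / p - s) * ‖avg m (𝓖.step j y) (𝓖.parent k Q)‖ₑ) := by
          refine levelNorm_mono hp fun Q hQ => ?_
          rw [← mul_add, incr]
          gcongr
          exact enorm_sub_le
      _ ≤ r ^ (j - (k + 1)) * 𝓖.levelNorm p j b +
          ENNReal.ofReal c₁ ^ (-s) * (r ^ (j - k) * 𝓖.levelNorm p j b) := by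
          refine (levelNorm_add_le hp (fun Q => m Q ^ (1 / p - s) * ‖avg m (𝓖.step j y) Q‖ₑ)
            (fun Q => m Q ^ (1 / p - s) * ‖avg m (𝓖.step j y) (𝓖.parent k Q)‖ₑ)).trans
            (add_le_add (base (k + 1) hkj) ?_)
          refine (levelNorm_parent_le h𝓖 hs hp k fun P => ‖avg m (𝓖.step j y) P‖ₑ).trans ?_
          gcongr
          exact base k (by omega)
      _ = _ := by
          rw [show j - k = (j - (k + 1)) + 1 by omega, pow_succ]
          ring

/-- The constant that compares the increments of a function with its Besov norm. -/
noncomputable def incrConst (c₁ c₂ s : ℝ) : ℝ≥0∞ :=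
  (1 + ENNReal.ofReal c₁ ^ (-s) * ENNReal.ofReal (c₂ ^ s)) * (1 - ENNReal.ofReal (c₂ ^ s))⁻¹

/-- The `n`-th partial sum of the step functions with values `y`. -/
noncomputable def Grid.stepSum (𝓖 : Grid m) (y : Set I → ℂ) (n : ℕ) : I → ℂ :=
  fun x => ∑ k ∈ Finset.range n, 𝓖.step k y x

theorem Grid.stepSum_succ (y : Set I → ℂ) (n : ℕ) :
    𝓖.stepSum y (n + 1) = 𝓖.stepSum y n + 𝓖.step n y := by
  ext x
  simp [stepSum, Finset.sum_range_succ]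

theorem Grid.memLp_stepSum [IsFiniteMeasure m] (y : Set I → ℂ) (n : ℕ) (r : ℝ≥0∞) :
    MemLp (𝓖.stepSum y n) r m :=
  memLp_finsetSum _ fun k _ => memLp_step k y r

theorem Grid.incr_add (v w : Set I → ℂ) (k : ℕ) (Q : Set I) :
    𝓖.incr (fun R => v R + w R) k Q = 𝓖.incr v k Q + 𝓖.incr w k Q := by
  cases k <;> simp only [incr]
  ring

theorem Grid.incr_avg_stepSum [IsFiniteMeasure m] (y : Set I → ℂ) (n k : ℕ) (Q : Set I) :
    𝓖.incr (avg m (𝓖.stepSum y n)) k Q =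
      ∑ j ∈ Finset.range n, 𝓖.incr (avg m (𝓖.step j y)) k Q := by
  induction n with
  | zero =>
    have : avg m (𝓖.stepSum y 0) = 0 := by
      ext Q
      simp [avg, stepSum]
    cases k <;> simp [incr, this]
  | succ n ih =>
    have : avg m (𝓖.stepSum y (n + 1)) =
        fun Q => avg m (𝓖.stepSum y n) Q + avg m (𝓖.step n y) Q := by
      ext Q
      rw [stepSum_succ]
      exact avg_add ((memLp_stepSum y n 1).integrable le_rfl)
        ((memLp_step n y 1).integrable le_rfl) Q
    rw [this, incr_add, ih, Finset.sum_range_succ]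

/-- Only layers `j = k + i` with `i ≥ 0` reach level `k`, each damped by `r ^ i`; the geometric
kernel then sums to `(1 - r)⁻¹`, uniformly in `n`. -/
theorem Grid.incrNorm_stepSum_le [IsFiniteMeasure m] (h𝓖 : 𝓖.IsGood c₁ c₂) (hs : 0 < s)
    (hp : 1 ≤ p) (hq : 1 ≤ q) {y : Set I → ℂ} {b : Set I → ℝ≥0∞}
    (hy : ∀ j, ∀ R ∈ 𝓖.sets j, ‖y R‖ₑ ≤ b R * m R ^ (s - 1 / p)) (n : ℕ) :
    𝓖.incrNorm s p q (avg m (𝓖.stepSum y n)) ≤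
      incrConst c₁ c₂ s * seqNorm q (fun k => 𝓖.levelNorm p k b) := by
  set r := ENNReal.ofReal (c₂ ^ s) with hr
  set K := 1 + ENNReal.ofReal c₁ ^ (-s) * r with hK
  let F : ℕ → ℕ → ℝ≥0∞ := fun k j =>
    𝓖.levelNorm p k (fun Q => m Q ^ (1 / p - s) * ‖𝓖.incr (avg m (𝓖.step j y)) k Q‖ₑ)
  have hF0 : ∀ k j, j < k → F k j = 0 := by
    intro k j hjk
    refine le_antisymm ((levelNorm_mono hp fun Q hQ => ?_).trans_eq (𝓖.levelNorm_zero hp)) zero_le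
    rw [incr_avg_step_eq_zero h𝓖 hjk hQ]
    simp
  have hF : ∀ k i, F k (k + i) ≤ K * (r ^ i * 𝓖.levelNorm p (k + i) b) := by
    intro k i
    have := levelNorm_incr_avg_step_le h𝓖 hs hp (Nat.le_add_right k i) (hy (k + i))
    rwa [Nat.add_sub_cancel_left] at this
  have hle : ∀ k, 𝓖.levelNorm p k
      (fun Q => m Q ^ (1 / p - s) * ‖𝓖.incr (avg m (𝓖.stepSum y n)) k Q‖ₑ) ≤
      K * ∑ i ∈ Finset.range n, r ^ i * 𝓖.levelNorm p (k + i) b := by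
    intro k
    calc _ ≤ 𝓖.levelNorm p k (fun Q => ∑ j ∈ Finset.range n,
          m Q ^ (1 / p - s) * ‖𝓖.incr (avg m (𝓖.step j y)) k Q‖ₑ) := by
          refine levelNorm_mono hp fun Q _ => ?_
          rw [incr_avg_stepSum, ← Finset.mul_sum]
          gcongr
          exact enorm_sum_le _ _
      _ ≤ ∑ j ∈ Finset.range n, F k j := levelNorm_sum_le hp n _
      -- Enlarging the range to `k + n` makes the part `j < k`, which vanishes, split off exactly,
      -- leaving `j = k + i` with `i < n`.
      _ ≤ ∑ j ∈ Finset.range (k + n), F k j :=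
          Finset.sum_le_sum_of_subset (Finset.range_mono (Nat.le_add_left n k))
      _ = ∑ i ∈ Finset.range n, F k (k + i) := by
          rw [Finset.sum_range_add, Finset.sum_eq_zero fun j hj => hF0 k j (Finset.mem_range.1 hj),
            zero_add]
      _ ≤ _ := by
          rw [Finset.mul_sum]
          exact Finset.sum_le_sum fun i _ => hF k i
  calc _ ≤ seqNorm q (fun k => K * ∑ i ∈ Finset.range n, r ^ i * 𝓖.levelNorm p (k + i) b) :=
        seqNorm_mono hle
    _ ≤ K * ((1 - r)⁻¹ * seqNorm q (fun k => 𝓖.levelNorm p k b)) := by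
        rw [seqNorm_const_mul hq]
        gcongr
        exact seqNorm_geometric_le hq n r (fun k => 𝓖.levelNorm p k b)
    _ = _ := by rw [incrConst, mul_assoc]

theorem Grid.avgConv_stepSum [IsFiniteMeasure m] (h𝓖 : 𝓖.IsGood c₁ c₂) (y : Set I → ℂ) (n : ℕ) :
    𝓖.AvgConv p (𝓖.stepSum y n) := by
  refine .of_const h𝓖 n fun k hk Q hQ => ?_
  obtain ⟨x, hx⟩ := nonempty_of_mem hQ
  refine ⟨𝓖.stepSum y n x, fun x' hx' => ?_⟩
  refine Finset.sum_congr rfl fun j hj => ?_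
  obtain ⟨z, hz⟩ := step_const_on h𝓖 ((Finset.mem_range.1 hj).le.trans hk) hQ y
  rw [hz x hx, hz x' hx']

/-- The values of a Souza atom representation. -/
theorem Grid.IsRep.exists_values {u : I →ₘ[m] ℂ} {c : Set I → ℂ} {a : Set I → I → ℂ}
    (h : 𝓖.IsRep (souzaAtoms m s p) p q u c a) :
    ∃ y : Set I → ℂ, (∀ k, ∀ Q ∈ 𝓖.sets k, ‖y Q‖ₑ ≤ ‖c Q‖ₑ * m Q ^ (s - 1 / p)) ∧
      ∀ k x, ∑ Q ∈ 𝓖.sets k, c Q * a Q x = 𝓖.step k y x := by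
  have hz : ∀ Q : Set I, ∃ z : ℂ, ∀ k, Q ∈ 𝓖.sets k → ∀ x ∈ Q, a Q x = z := by
    intro Q
    by_cases hQ : ∃ k, Q ∈ 𝓖.sets k
    · obtain ⟨k, hQ⟩ := hQ
      obtain ⟨z, hz⟩ := (h.atom k Q hQ).2.1
      exact ⟨z, fun _ _ => hz⟩
    · exact ⟨0, fun k hk => absurd ⟨k, hk⟩ hQ⟩
  choose z hz using hz
  refine ⟨fun Q => c Q * z Q, fun k Q hQ => ?_, fun k x => ?_⟩
  · rw [enorm_mul]
    gcongr
    refine le_trans ?_ (h.atom k Q hQ).2.2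
    -- Since `Q` has positive measure, the essential bound on the atom bounds its constant value on
    -- `Q`.
    have h0 : (m.restrict Q) ≠ 0 := by
      simpa using (𝓖.measure_pos k Q hQ).ne'
    calc ‖z Q‖ₑ = eLpNorm (fun _ : I => z Q) ∞ (m.restrict Q) := by
          rw [eLpNorm_const _ (by simp) h0]; simp
      _ = eLpNorm (a Q) ∞ (m.restrict Q) := by
          refine eLpNorm_congr_ae ?_
          filter_upwards [ae_restrict_mem (𝓖.measurableSet k Q hQ)] with x hx
          exact (hz Q k hQ x hx).symm
      _ ≤ _ := eLpNorm_mono_measure _ Measure.restrict_le_self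
  · refine Finset.sum_congr rfl fun Q hQ => ?_
    by_cases hx : x ∈ Q
    · rw [Set.indicator_of_mem hx, hz Q k hQ x hx]
    · rw [Set.indicator_of_notMem hx, (h.atom k Q hQ).1 x hx, mul_zero]

/-- Both claims hold for the partial sums, uniformly for the first, and pass to the `L^p` limit. -/
theorem Grid.IsRep.incrNorm_le_and_avgConv [IsFiniteMeasure m] (h𝓖 : 𝓖.IsGood c₁ c₂) (hs : 0 < s)
    (hp : 1 ≤ p) (hq : 1 ≤ q) {u : I →ₘ[m] ℂ} {c : Set I → ℂ} {a : Set I → I → ℂ}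
    (h : 𝓖.IsRep (souzaAtoms m s p) p q u c a) :
    𝓖.incrNorm s p q (avg m u) ≤ incrConst c₁ c₂ s * 𝓖.cost p q c ∧ 𝓖.AvgConv p u := by
  obtain ⟨y, hy, hstep⟩ := h.exists_values
  have hlim : Tendsto (fun n => eLpNorm (⇑u - 𝓖.stepSum y n) (ENNReal.ofReal p) m) atTop (𝓝 0) := by
    have := h.tendsto
    simp_rw [hstep] at this
    exact this
  have hS := fun n => 𝓖.memLp_stepSum y n (ENNReal.ofReal p)
  constructor
  · rw [cost_eq]
    refine incrNorm_le_of_tendsto h𝓖 hq (fun k Q hQ => ?_)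
      (Eventually.of_forall fun n => incrNorm_stepSum_le h𝓖 hs hp hq hy n)
    exact tendsto_avg hp h.memLp hS hlim (𝓖.measure_pos k Q hQ).ne'
  · exact .of_approx h𝓖 hp h.memLp hS (avgConv_stepSum h𝓖 y) hlim

/-! ### The representation by increments -/

open Classical in
/-- The level of a set of the grid. -/
noncomputable def Grid.level (𝓖 : Grid m) (Q : Set I) : ℕ :=
  if h : ∃ k, Q ∈ 𝓖.sets k then h.choose else 0

theorem Grid.level_eq (hQ : Q ∈ 𝓖.sets k) : 𝓖.level Q = k := by
  have h : ∃ k, Q ∈ 𝓖.sets k := ⟨k, hQ⟩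
  rw [level, dif_pos h]
  by_contra hne
  exact 𝓖.ne_of_level_ne _ _ hne Q h.choose_spec Q hQ rfl

/-- The increments telescope along the chain of parents of a point. Equality is only almost
everywhere because a level covers the space up to a null set. -/
theorem Grid.stepSum_incr_ae_eq (h𝓖 : 𝓖.IsGood c₁ c₂) (v : Set I → ℂ) (n : ℕ) :
    (fun x => ∑ k ∈ Finset.range (n + 1), 𝓖.step k (𝓖.incr v k) x) =ᵐ[m] 𝓖.step n v := by
  induction n with
  | zero =>
    filter_upwards [ae_mem h𝓖 0] with x ⟨Q, hQ, hx⟩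
    simp [step_apply h𝓖 _ hQ hx, incr]
  | succ n ih =>
    filter_upwards [ih, ae_mem h𝓖 (n + 1)] with x hx ⟨Q, hQ, hxQ⟩
    obtain ⟨hP, hQP⟩ := parent_spec h𝓖 hQ
    rw [Finset.sum_range_succ, hx, step_apply h𝓖 _ hQ hxQ, step_apply h𝓖 _ hQ hxQ,
      step_apply h𝓖 _ hP (hQP hxQ), incr]
    ring

/-- The factor `|Q|^s`, left over between the `L^p` and the Besov weights, decays geometrically with
the level; this yields absolute convergence in `L^p`. -/
theorem Grid.eLpNorm_step_le [IsFiniteMeasure m] (h𝓖 : 𝓖.IsGood c₁ c₂) (hs : 0 < s) (hp : 1 ≤ p)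
    (k : ℕ) (w : Set I → ℂ) :
    eLpNorm (𝓖.step k w) (ENNReal.ofReal p) m ≤ ENNReal.ofReal (c₂ ^ s) ^ k * m Set.univ ^ s *
      𝓖.levelNorm p k (fun Q => m Q ^ (1 / p - s) * ‖w Q‖ₑ) := by
  have hp0 : 0 < p := by linarith
  rw [← levelNorm_const_mul hp, ← ENNReal.rpow_le_rpow_iff hp0, eLpNorm_step_rpow h𝓖 hp,
    levelNorm_rpow hp]
  refine Finset.sum_le_sum fun Q hQ => ?_
  have hQ0 := (𝓖.measure_pos k Q hQ).ne'
  calc ‖w Q‖ₑ ^ p * m Q = (m Q ^ s * (m Q ^ (1 / p - s) * ‖w Q‖ₑ)) ^ p := by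
        rw [← mul_assoc, ← ENNReal.rpow_add _ _ hQ0 (measure_ne_top m Q), add_sub_cancel,
          ENNReal.mul_rpow_of_nonneg _ _ hp0.le, ← ENNReal.rpow_mul, one_div_mul_cancel hp0.ne',
          ENNReal.rpow_one, mul_comm]
    _ ≤ _ := by
        gcongr
        exact measure_rpow_le h𝓖 hs hQ

/-- The values `v` need not be the averages of `u`: any values whose step functions converge to `u`
will do. This freedom is what makes products tractable. -/
theorem Grid.exists_isRep_of_incrNorm [IsFiniteMeasure m] (h𝓖 : 𝓖.IsGood c₁ c₂) (hs : 0 < s)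
    (hp : 1 ≤ p) (hq : 1 ≤ q) {u : I →ₘ[m] ℂ} (hu : MemLp u (ENNReal.ofReal p) m)
    {v : Set I → ℂ} (hv : 𝓖.incrNorm s p q v < ∞)
    (hlim : Tendsto (fun n => eLpNorm (⇑u - 𝓖.step n v) (ENNReal.ofReal p) m) atTop (𝓝 0)) :
    ∃ c a, 𝓖.IsRep (souzaAtoms m s p) p q u c a ∧ 𝓖.cost p q c = 𝓖.incrNorm s p q v := by
  have hp0 : 0 < p := by linarith
  have hfin : ∀ k, ∀ Q ∈ 𝓖.sets k, ∀ t : ℝ, m Q ^ t ≠ ∞ := fun k Q hQ t =>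
    ENNReal.rpow_ne_top_of_ne_zero (𝓖.measure_pos k Q hQ).ne' (measure_ne_top m Q)
  have hen : ∀ k, ∀ Q ∈ 𝓖.sets k, ∀ t : ℝ, ‖(((m Q ^ t).toReal : ℝ) : ℂ)‖ₑ = m Q ^ t := by
    intro k Q hQ t
    rw [← ofReal_norm, Complex.norm_real, Real.norm_eq_abs, abs_of_nonneg ENNReal.toReal_nonneg,
      ENNReal.ofReal_toReal (hfin k Q hQ t)]
  -- The atoms have maximal height `|Q|^{s-1/p}`, compensated in the coefficients. Coefficients are
  -- indexed by sets alone, so `level` recovers which increment to use.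
  let c : Set I → ℂ := fun Q => ((m Q ^ (1 / p - s)).toReal : ℝ) * 𝓖.incr v (𝓖.level Q) Q
  let a : Set I → I → ℂ := fun Q => Q.indicator fun _ => (((m Q ^ (s - 1 / p)).toReal : ℝ) : ℂ)
  have hcost : 𝓖.cost p q c = 𝓖.incrNorm s p q v := by
    rw [cost_eq, incrNorm]
    congr 1
    ext k
    refine le_antisymm (levelNorm_mono hp fun Q hQ => ?_) (levelNorm_mono hp fun Q hQ => ?_) <;>
    simp only [c, enorm_mul, hen k Q hQ, level_eq hQ, le_refl]
  have hstep : ∀ k x, ∑ Q ∈ 𝓖.sets k, c Q * a Q x = 𝓖.step k (𝓖.incr v k) x := by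
    intro k x
    refine Finset.sum_congr rfl fun Q hQ => ?_
    by_cases hx : x ∈ Q
    · simp only [a, c, Set.indicator_of_mem hx, level_eq hQ]
      rw [mul_right_comm, ← Complex.ofReal_mul, ← ENNReal.toReal_mul,
        ← ENNReal.rpow_add _ _ (𝓖.measure_pos k Q hQ).ne' (measure_ne_top m Q)]
      simp
    · simp [a, Set.indicator_of_notMem hx]
  refine ⟨c, a, ⟨hu, fun k Q hQ => ⟨fun x hx => Set.indicator_of_notMem hx _, ⟨_, fun x hx =>
    Set.indicator_of_mem hx _⟩, ?_⟩, hcost ▸ hv, ?_, ?_⟩, hcost⟩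
  · rw [← hen k Q hQ]
    simpa only [eLpNorm_exponent_top] using
      (eLpNormEssSup_indicator_const_le Q (((m Q ^ (s - 1 / p)).toReal : ℝ) : ℂ) (μ := m))
  · simp_rw [hstep, max_eq_left hp, div_self hp0.ne', ENNReal.rpow_one]
    set r := ENNReal.ofReal (c₂ ^ s) with hr
    have hr1 : r < 1 := ratio_rpow_lt_one h𝓖 hs
    calc _ ≤ ∑' k, r ^ k * (m Set.univ ^ s * 𝓖.incrNorm s p q v) := by
          refine ENNReal.tsum_le_tsum fun k => ?_
          refine (eLpNorm_step_le h𝓖 hs hp k _).trans ?_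
          rw [mul_assoc]
          gcongr
          exact le_seqNorm hq _ k
      _ = (1 - r)⁻¹ * (m Set.univ ^ s * 𝓖.incrNorm s p q v) := by
          rw [ENNReal.tsum_mul_right, ENNReal.tsum_geometric]
      _ < ∞ := by
          refine ENNReal.mul_lt_top ?_ (ENNReal.mul_lt_top ?_ hv)
          · simpa using hr1
          · exact ENNReal.rpow_lt_top_of_nonneg hs.le (measure_ne_top m _)
  · simp_rw [hstep]
    -- The levels `0, ..., n`, which are `n + 1` layers, sum to the step function of level `n`.
    rw [← tendsto_add_atTop_iff_nat 1]
    refine hlim.congr fun n => eLpNorm_congr_ae ?_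
    filter_upwards [stepSum_incr_ae_eq h𝓖 v n] with x hx
    rw [hx, Pi.sub_apply]

theorem Grid.IsRep.besovNorm_le {u : I →ₘ[m] ℂ} {c : Set I → ℂ} {a : Set I → I → ℂ}
    (h : 𝓖.IsRep (souzaAtoms m s p) p q u c a) : 𝓖.besovNorm s p q u ≤ 𝓖.cost p q c :=
  iInf₂_le_of_le c a (iInf_le_of_le h le_rfl)

theorem Grid.besovNorm_le_incrNorm [IsFiniteMeasure m] (h𝓖 : 𝓖.IsGood c₁ c₂) (hs : 0 < s)
    (hp : 1 ≤ p) (hq : 1 ≤ q) {u : I →ₘ[m] ℂ} (hu : MemLp u (ENNReal.ofReal p) m)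
    {v : Set I → ℂ} (hv : 𝓖.incrNorm s p q v < ∞)
    (hlim : Tendsto (fun n => eLpNorm (⇑u - 𝓖.step n v) (ENNReal.ofReal p) m) atTop (𝓝 0)) :
    u ∈ 𝓖.besov s p q ∧ 𝓖.besovNorm s p q u ≤ 𝓖.incrNorm s p q v := by
  obtain ⟨c, a, h, hc⟩ := exists_isRep_of_incrNorm h𝓖 hs hp hq hu hv hlim
  exact ⟨⟨c, a, h⟩, hc ▸ h.besovNorm_le⟩

theorem one_le_incrConst : 1 ≤ incrConst c₁ c₂ s := by
  refine one_le_mul le_self_add ?_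
  rw [ENNReal.one_le_inv]
  exact tsub_le_self

theorem Grid.incrConst_lt_top (h𝓖 : 𝓖.IsGood c₁ c₂) (hs : 0 < s) : incrConst c₁ c₂ s < ∞ := by
  have hr1 := ratio_rpow_lt_one h𝓖 hs
  refine ENNReal.mul_lt_top (ENNReal.add_lt_top.2 ⟨ENNReal.one_lt_top, ENNReal.mul_lt_top ?_
    ENNReal.ofReal_lt_top⟩) (by simpa using hr1)
  exact (ENNReal.rpow_ne_top_of_ne_zero (by simpa using h𝓖.pos) ENNReal.ofReal_ne_top).lt_top

theorem Grid.incrNorm_le_besovNorm [IsFiniteMeasure m] (h𝓖 : 𝓖.IsGood c₁ c₂) (hs : 0 < s)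
    (hp : 1 ≤ p) (hq : 1 ≤ q) (u : I →ₘ[m] ℂ) :
    𝓖.incrNorm s p q (avg m u) ≤ incrConst c₁ c₂ s * 𝓖.besovNorm s p q u := by
  have h0 : incrConst c₁ c₂ s ≠ 0 := (zero_lt_one.trans_le one_le_incrConst).ne'
  have hT := (incrConst_lt_top h𝓖 hs).ne
  simp only [besovNorm, ENNReal.mul_iInf_of_ne h0 hT]
  exact le_iInf fun c => le_iInf fun a => le_iInf fun h =>
    (h.incrNorm_le_and_avgConv h𝓖 hs hp hq).1

/-! ### Linear structure -/

/-- Atoms on `Q` form an absolutely convex set. If `z = w = 0`, division by zero gives the zero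
function, still an atom. -/
theorem add_mem_souzaAtoms {a b : I → ℂ} {z w : ℂ} (hM : m Q ^ (s - 1 / p) ≠ ∞)
    (ha : a ∈ souzaAtoms m s p Q) (hb : b ∈ souzaAtoms m s p Q) :
    (fun x => (z * a x + w * b x) / ((‖z‖ + ‖w‖ : ℝ) : ℂ)) ∈ souzaAtoms m s p Q := by
  obtain ⟨ha0, ⟨α, hα⟩, ha⟩ := ha
  obtain ⟨hb0, ⟨β, hβ⟩, hb⟩ := hb
  refine ⟨fun x hx => by simp [ha0 x hx, hb0 x hx], ⟨(z * α + w * β) / ((‖z‖ + ‖w‖ : ℝ) : ℂ),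
    fun x hx => by simp only [hα x hx, hβ x hx]⟩, ?_⟩
  rw [eLpNorm_exponent_top] at ha hb ⊢
  refine eLpNormEssSup_le_of_ae_enorm_bound ?_
  filter_upwards [ae_le_eLpNormEssSup (f := a) (μ := m), ae_le_eLpNormEssSup (f := b) (μ := m)]
    with x hxa hxb
  have key : ∀ y : ℂ, ‖y‖ₑ ≤ m Q ^ (s - 1 / p) ↔ ‖y‖ ≤ (m Q ^ (s - 1 / p)).toReal := by
    intro y
    rw [← ofReal_norm, ENNReal.ofReal_le_iff_le_toReal hM]
  have hxa := (key _).1 (hxa.trans ha)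
  have hxb := (key _).1 (hxb.trans hb)
  rw [key, norm_div, Complex.norm_real, Real.norm_eq_abs, abs_of_nonneg (by positivity)]
  refine div_le_of_le_mul₀ (by positivity) ENNReal.toReal_nonneg ?_
  calc _ ≤ ‖z‖ * ‖a x‖ + ‖w‖ * ‖b x‖ := by
        simpa only [norm_mul] using norm_add_le (z * a x) (w * b x)
    _ ≤ ‖z‖ * (m Q ^ (s - 1 / p)).toReal + ‖w‖ * (m Q ^ (s - 1 / p)).toReal := by gcongr
    _ = _ := by ring

/-- With coefficients `|c Q| + |c' Q|` the two atoms on each `Q` merge into one, and Minkowski on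
levels and in `ℓ^q` makes the cost subadditive. -/
theorem Grid.exists_isRep_add [IsFiniteMeasure m] (hp : 1 ≤ p) (hq : 1 ≤ q)
    {u u' : I →ₘ[m] ℂ} {c c' : Set I → ℂ} {a a' : Set I → I → ℂ}
    (h : 𝓖.IsRep (souzaAtoms m s p) p q u c a) (h' : 𝓖.IsRep (souzaAtoms m s p) p q u' c' a') :
    ∃ d b, 𝓖.IsRep (souzaAtoms m s p) p q (u + u') d b ∧
      𝓖.cost p q d ≤ 𝓖.cost p q c + 𝓖.cost p q c' := by
  have hp0 : 0 < p := by linarith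
  have h1 : (1 : ℝ≥0∞) ≤ ENNReal.ofReal p := by simpa using hp
  let d : Set I → ℂ := fun Q => ((‖c Q‖ + ‖c' Q‖ : ℝ) : ℂ)
  let b : Set I → I → ℂ := fun Q x => (c Q * a Q x + c' Q * a' Q x) / d Q
  have hdb : ∀ Q x, d Q * b Q x = c Q * a Q x + c' Q * a' Q x := by
    intro Q x
    by_cases hd : d Q = 0
    · have h0 : ‖c Q‖ + ‖c' Q‖ = 0 := by simpa only [d, Complex.ofReal_eq_zero] using hd
      have hc : c Q = 0 := norm_eq_zero.1 (by linarith [norm_nonneg (c Q), norm_nonneg (c' Q)])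
      have hc' : c' Q = 0 := norm_eq_zero.1 (by linarith [norm_nonneg (c Q), norm_nonneg (c' Q)])
      simp [hd, hc, hc']
    · exact mul_div_cancel₀ _ hd
  have hcost : 𝓖.cost p q d ≤ 𝓖.cost p q c + 𝓖.cost p q c' := by
    simp only [cost_eq]
    refine (seqNorm_mono fun k => ?_).trans (seqNorm_add_le hq _ _)
    refine (levelNorm_mono hp fun Q _ => ?_).trans
      (levelNorm_add_le hp (fun Q => ‖c Q‖ₑ) (fun Q => ‖c' Q‖ₑ))
    simp only [d, ← ofReal_norm]
    rw [Complex.norm_real, Real.norm_eq_abs, abs_of_nonneg (by positivity),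
      ENNReal.ofReal_add (norm_nonneg _) (norm_nonneg _)]
  obtain ⟨y, -, hy⟩ := h.exists_values
  obtain ⟨y', -, hy'⟩ := h'.exists_values
  have hsum : ∀ k x, ∑ Q ∈ 𝓖.sets k, d Q * b Q x = 𝓖.step k y x + 𝓖.step k y' x := by
    intro k x
    simp only [hdb, Finset.sum_add_distrib, hy, hy']
  have hst : ∀ k v, AEStronglyMeasurable (𝓖.step k v) m := fun k v =>
    (stronglyMeasurable_step k v).aestronglyMeasurable
  refine ⟨d, b, ⟨(h.memLp.add h'.memLp).ae_eq (AEEqFun.coeFn_add u u').symm, fun k Q hQ => ?_,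
    hcost.trans_lt (ENNReal.add_lt_top.2 ⟨h.cost_lt_top, h'.cost_lt_top⟩), ?_, ?_⟩, hcost⟩
  · exact add_mem_souzaAtoms (ENNReal.rpow_ne_top_of_ne_zero (𝓖.measure_pos k Q hQ).ne'
      (measure_ne_top m Q)) (h.atom k Q hQ) (h'.atom k Q hQ)
  · have e := h.absConv
    have e' := h'.absConv
    simp only [hy, hy', hsum, max_eq_left hp, div_self hp0.ne', ENNReal.rpow_one] at e e' ⊢
    refine lt_of_le_of_lt ?_ (ENNReal.add_lt_top.2 ⟨e, e'⟩)
    rw [← ENNReal.tsum_add]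
    exact ENNReal.tsum_le_tsum fun k => eLpNorm_add_le (hst k y) (hst k y') h1
  · have e := h.tendsto.add h'.tendsto
    simp only [hy, hy', hsum, add_zero] at e ⊢
    refine tendsto_of_tendsto_of_tendsto_of_le_of_le tendsto_const_nhds e (fun _ => zero_le)
      fun n => ?_
    have hS : ∀ w : Set I → ℂ, AEStronglyMeasurable (𝓖.stepSum w n) m := fun w =>
      (memLp_stepSum w n 1).aestronglyMeasurable
    refine le_trans (le_of_eq (eLpNorm_congr_ae ?_)) (eLpNorm_add_le
      (u.aestronglyMeasurable.sub (hS y)) (u'.aestronglyMeasurable.sub (hS y')) h1)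
    filter_upwards [AEEqFun.coeFn_add u u'] with x hx
    simp only [hx, Pi.add_apply, Finset.sum_add_distrib]
    ring

theorem Grid.isRep_smul [IsFiniteMeasure m] (hp : 1 ≤ p) (hq : 1 ≤ q)
    {u : I →ₘ[m] ℂ} {c : Set I → ℂ} {a : Set I → I → ℂ} (z : ℂ)
    (h : 𝓖.IsRep (souzaAtoms m s p) p q u c a) :
    𝓖.IsRep (souzaAtoms m s p) p q (z • u) (fun Q => z * c Q) a ∧
      𝓖.cost p q (fun Q => z * c Q) = ‖z‖ₑ * 𝓖.cost p q c := by
  have hp0 : 0 < p := by linarith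
  have hcost : 𝓖.cost p q (fun Q => z * c Q) = ‖z‖ₑ * 𝓖.cost p q c := by
    simp only [cost_eq, enorm_mul, levelNorm_const_mul hp, seqNorm_const_mul hq]
  have hsum : ∀ k x, ∑ Q ∈ 𝓖.sets k, z * c Q * a Q x = z * ∑ Q ∈ 𝓖.sets k, c Q * a Q x := by
    intro k x
    rw [Finset.mul_sum]
    exact Finset.sum_congr rfl fun Q _ => mul_assoc _ _ _
  refine ⟨⟨(h.memLp.const_smul z).ae_eq (AEEqFun.coeFn_smul z u).symm, h.atom,
    hcost ▸ ENNReal.mul_lt_top enorm_lt_top h.cost_lt_top, ?_, ?_⟩, hcost⟩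
  · have e := h.absConv
    simp only [max_eq_left hp, div_self hp0.ne', ENNReal.rpow_one] at e ⊢
    refine lt_of_eq_of_lt ?_ (ENNReal.mul_lt_top (enorm_lt_top (x := z)) e)
    rw [← ENNReal.tsum_mul_left]
    refine tsum_congr fun k => ?_
    rw [← eLpNorm_const_smul]
    congr 1
    ext x
    simp only [hsum, Pi.smul_apply, smul_eq_mul]
  · have e := ENNReal.Tendsto.const_mul (a := ‖z‖ₑ) h.tendsto (Or.inr enorm_ne_top)
    rw [mul_zero] at e
    refine e.congr fun n => ?_
    rw [← eLpNorm_const_smul]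
    refine eLpNorm_congr_ae ?_
    filter_upwards [AEEqFun.coeFn_smul z u] with x hx
    simp only [hsum, hx, Pi.smul_apply, smul_eq_mul, ← Finset.mul_sum, mul_sub]

theorem Grid.besovNorm_add_le [IsFiniteMeasure m] (hp : 1 ≤ p) (hq : 1 ≤ q) (u u' : I →ₘ[m] ℂ) :
    𝓖.besovNorm s p q (u + u') ≤ 𝓖.besovNorm s p q u + 𝓖.besovNorm s p q u' := by
  conv_rhs => simp only [besovNorm, ENNReal.iInf_add, ENNReal.add_iInf]
  refine le_iInf fun c' => le_iInf fun a' => le_iInf fun h' => le_iInf fun c => le_iInf fun a =>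
    le_iInf fun h => ?_
  obtain ⟨d, b, hd, hcost⟩ := exists_isRep_add hp hq h h'
  exact hd.besovNorm_le.trans hcost

theorem Grid.add_mem_besov [IsFiniteMeasure m] (hp : 1 ≤ p) (hq : 1 ≤ q) {u u' : I →ₘ[m] ℂ}
    (h : u ∈ 𝓖.besov s p q) (h' : u' ∈ 𝓖.besov s p q) : u + u' ∈ 𝓖.besov s p q := by
  obtain ⟨c, a, h⟩ := h
  obtain ⟨c', a', h'⟩ := h'
  obtain ⟨d, b, hd, -⟩ := exists_isRep_add hp hq h h'
  exact ⟨d, b, hd⟩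

theorem Grid.smul_mem_besov [IsFiniteMeasure m] (hp : 1 ≤ p) (hq : 1 ≤ q) {u : I →ₘ[m] ℂ} (z : ℂ)
    (h : u ∈ 𝓖.besov s p q) : z • u ∈ 𝓖.besov s p q := by
  obtain ⟨c, a, h⟩ := h
  exact ⟨_, a, (isRep_smul hp hq z h).1⟩

theorem Grid.besovNorm_smul_le [IsFiniteMeasure m] (hp : 1 ≤ p) (hq : 1 ≤ q) {u : I →ₘ[m] ℂ}
    (z : ℂ) (h : u ∈ 𝓖.besov s p q) :
    𝓖.besovNorm s p q (z • u) ≤ ‖z‖ₑ * 𝓖.besovNorm s p q u := by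
  have key : ∀ c a, 𝓖.IsRep (souzaAtoms m s p) p q u c a →
      𝓖.besovNorm s p q (z • u) ≤ ‖z‖ₑ * 𝓖.cost p q c := fun c a h =>
    (isRep_smul hp hq z h).1.besovNorm_le.trans (isRep_smul hp hq z h).2.le
  by_cases hz : z = 0
  · obtain ⟨c, a, h⟩ := h
    simpa [hz] using key c a h
  · rw [besovNorm.eq_def 𝓖 s p q u]
    simp only [ENNReal.mul_iInf_of_ne (enorm_ne_zero.2 hz) enorm_ne_top]
    exact le_iInf fun c => le_iInf fun a => le_iInf fun h => key c a h

theorem Grid.besovNorm_smul [IsFiniteMeasure m] (hp : 1 ≤ p) (hq : 1 ≤ q) {u : I →ₘ[m] ℂ}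
    (z : ℂ) (h : u ∈ 𝓖.besov s p q) :
    𝓖.besovNorm s p q (z • u) = ‖z‖ₑ * 𝓖.besovNorm s p q u := by
  refine le_antisymm (besovNorm_smul_le hp hq z h) ?_
  by_cases hz : z = 0
  · simp [hz]
  · have := besovNorm_smul_le hp hq z⁻¹ (smul_mem_besov hp hq z h)
    rw [inv_smul_smul₀ hz] at this
    calc _ ≤ ‖z‖ₑ * (‖z⁻¹‖ₑ * 𝓖.besovNorm s p q (z • u)) := by gcongr
      _ = _ := by rw [← mul_assoc, ← enorm_mul, mul_inv_cancel₀ hz]; simp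

theorem Grid.besovNorm_lt_top {u : I →ₘ[m] ℂ} (h : u ∈ 𝓖.besov s p q) :
    𝓖.besovNorm s p q u < ∞ := by
  obtain ⟨c, a, h⟩ := h
  exact h.besovNorm_le.trans_lt h.cost_lt_top

theorem Grid.zero_mem_besov [IsFiniteMeasure m] (h𝓖 : 𝓖.IsGood c₁ c₂) (hs : 0 < s) (hp : 1 ≤ p)
    (hq : 1 ≤ q) : (0 : I →ₘ[m] ℂ) ∈ 𝓖.besov s p q := by
  have hincr : 𝓖.incrNorm s p q 0 = 0 := by
    refine le_antisymm ((seqNorm_mono fun k => ?_).trans_eq (seqNorm_zero hq)) zero_le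
    refine (levelNorm_mono hp fun Q _ => ?_).trans_eq (levelNorm_zero hp)
    cases k <;> simp [incr]
  refine (besovNorm_le_incrNorm h𝓖 hs hp hq (v := 0) ?_ (by simp [hincr]) ?_).1
  · exact (MemLp.zero (ε := ℂ)).ae_eq AEEqFun.coeFn_zero.symm
  · refine tendsto_const_nhds.congr fun n => ?_
    symm
    rw [← eLpNorm_zero (α := I) (ε := ℂ) (p := ENNReal.ofReal p) (μ := m)]
    refine eLpNorm_congr_ae ?_
    filter_upwards [AEEqFun.coeFn_zero (μ := m) (β := ℂ)] with x hx
    simp [hx, step]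

/-! ### Products -/

/-- A discrete Leibniz rule: one increment is multiplied by a value on `Q`, the other by a value on
the parent, and both values are bounded. -/
theorem Grid.incrNorm_mul_le (h𝓖 : 𝓖.IsGood c₁ c₂) (hp : 1 ≤ p) (hq : 1 ≤ q)
    {v w : Set I → ℂ} {A B : ℝ≥0∞} (hv : ∀ k, ∀ Q ∈ 𝓖.sets k, ‖v Q‖ₑ ≤ A)
    (hw : ∀ k, ∀ Q ∈ 𝓖.sets k, ‖w Q‖ₑ ≤ B) :
    𝓖.incrNorm s p q (fun Q => v Q * w Q) ≤
      B * 𝓖.incrNorm s p q v + A * 𝓖.incrNorm s p q w := by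
  simp only [incrNorm]
  rw [← seqNorm_const_mul hq, ← seqNorm_const_mul hq]
  refine (seqNorm_mono fun k => ?_).trans (seqNorm_add_le hq _ _)
  rw [← levelNorm_const_mul hp, ← levelNorm_const_mul hp]
  refine (levelNorm_mono hp fun Q hQ => ?_).trans (levelNorm_add_le hp _ _)
  have key : ‖𝓖.incr (fun Q => v Q * w Q) k Q‖ₑ ≤
      B * ‖𝓖.incr v k Q‖ₑ + A * ‖𝓖.incr w k Q‖ₑ := by
    cases k with
    | zero =>
      simp only [incr, enorm_mul]
      refine le_trans ?_ le_self_add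
      rw [mul_comm]
      gcongr
      exact hw 0 Q hQ
    | succ k =>
      have hP := (parent_spec h𝓖 hQ).1
      simp only [incr]
      rw [show v Q * w Q - v (𝓖.parent k Q) * w (𝓖.parent k Q) =
        w Q * (v Q - v (𝓖.parent k Q)) + v (𝓖.parent k Q) * (w Q - w (𝓖.parent k Q)) by ring]
      refine (enorm_add_le _ _).trans ?_
      rw [enorm_mul, enorm_mul]
      gcongr
      · exact hw _ Q hQ
      · exact hv _ _ hP
  calc _ ≤ m Q ^ (1 / p - s) * (B * ‖𝓖.incr v k Q‖ₑ + A * ‖𝓖.incr w k Q‖ₑ) := by gcongr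
    _ = _ := by ring

theorem Grid.eLpNorm_step_avg_top_le [IsFiniteMeasure m] (h𝓖 : 𝓖.IsGood c₁ c₂) (k : ℕ)
    (f : I → ℂ) : eLpNorm (𝓖.step k (avg m f)) ∞ m ≤ eLpNorm f ∞ m := by
  rw [eLpNorm_exponent_top (f := 𝓖.step k (avg m f))]
  refine eLpNormEssSup_le_of_ae_enorm_bound ?_
  filter_upwards [ae_mem h𝓖 k] with x ⟨Q, hQ, hx⟩
  rw [step_apply h𝓖 _ hQ hx]
  exact enorm_avg_le_top (𝓖.measure_pos k Q hQ).ne'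

/-- With `F`, `G` the step functions of averages, `fg - FG = g(f - F) + F(g - G)`, where `F` is
bounded by the sup norm of `f`. -/
theorem Grid.tendsto_step_mul [IsFiniteMeasure m] (h𝓖 : 𝓖.IsGood c₁ c₂) (hp : 1 ≤ p)
    (hf : MemLp f ∞ m) (hg : MemLp g ∞ m) (hcf : 𝓖.AvgConv p f) (hcg : 𝓖.AvgConv p g) :
    Tendsto (fun n => eLpNorm (f * g - 𝓖.step n (fun Q => avg m f Q * avg m g Q))
      (ENNReal.ofReal p) m) atTop (𝓝 0) := by
  have h1 : (1 : ℝ≥0∞) ≤ ENNReal.ofReal p := by simpa using hp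
  have e := (ENNReal.Tendsto.const_mul (a := eLpNorm g ∞ m) hcf (Or.inr hg.eLpNorm_ne_top)).add
    (ENNReal.Tendsto.const_mul (a := eLpNorm f ∞ m) hcg (Or.inr hf.eLpNorm_ne_top))
  simp only [mul_zero, add_zero] at e
  refine tendsto_of_tendsto_of_tendsto_of_le_of_le tendsto_const_nhds e (fun _ => zero_le)
    fun n => ?_
  have hst : ∀ v, AEStronglyMeasurable (𝓖.step n v) m := fun v =>
    (stronglyMeasurable_step n v).aestronglyMeasurable
  have hfm := hf.aestronglyMeasurable
  have hgm := hg.aestronglyMeasurable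
  have hae : f * g - 𝓖.step n (fun Q => avg m f Q * avg m g Q) =ᵐ[m]
      g • (f - 𝓖.step n (avg m f)) + 𝓖.step n (avg m f) • (g - 𝓖.step n (avg m g)) := by
    filter_upwards [ae_mem h𝓖 n] with x ⟨Q, hQ, hx⟩
    simp only [Pi.sub_apply, Pi.mul_apply, Pi.add_apply, smul_eq_mul,
      step_apply h𝓖 _ hQ hx]
    ring
  rw [eLpNorm_congr_ae hae]
  refine (eLpNorm_add_le (hgm.smul (hfm.sub (hst _))) ((hst _).smul (hgm.sub (hst _))) h1).trans ?_
  refine add_le_add (eLpNorm_smul_le_eLpNorm_top_mul_eLpNorm _ (hfm.sub (hst _)) _) ?_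
  refine (eLpNorm_smul_le_eLpNorm_top_mul_eLpNorm _ (hgm.sub (hst _)) _).trans ?_
  gcongr
  exact eLpNorm_step_avg_top_le h𝓖 n f

theorem memLp_top_mul {u w : I →ₘ[m] ℂ} (hu : MemLp u ∞ m) (hw : MemLp w ∞ m) :
    MemLp (u * w : I →ₘ[m] ℂ) ∞ m ∧
      eLpNorm (u * w : I →ₘ[m] ℂ) ∞ m ≤ eLpNorm u ∞ m * eLpNorm w ∞ m := by
  have hcoe := AEEqFun.coeFn_mul u w
  have hle : eLpNorm (u * w : I →ₘ[m] ℂ) ∞ m ≤ eLpNorm u ∞ m * eLpNorm w ∞ m :=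
    (eLpNorm_congr_ae hcoe).trans_le
      (eLpNorm_smul_le_eLpNorm_top_mul_eLpNorm (f := ⇑w) ∞ hw.aestronglyMeasurable ⇑u)
  exact ⟨⟨AEEqFun.aestronglyMeasurable _,
    hle.trans_lt (ENNReal.mul_lt_top hu.eLpNorm_lt_top hw.eLpNorm_lt_top)⟩, hle⟩

theorem Grid.mul_mem_besovLinfty [IsFiniteMeasure m] (h𝓖 : 𝓖.IsGood c₁ c₂) (hs : 0 < s)
    (hp : 1 ≤ p) (hq : 1 ≤ q) {u w : I →ₘ[m] ℂ} (hu : u ∈ 𝓖.besovLinfty s p q)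
    (hw : w ∈ 𝓖.besovLinfty s p q) :
    u * w ∈ 𝓖.besovLinfty s p q ∧
      𝓖.besovLinftyNorm s p q (u * w) ≤
        incrConst c₁ c₂ s * 𝓖.besovLinftyNorm s p q u * 𝓖.besovLinftyNorm s p q w := by
  obtain ⟨⟨c, a, hru⟩, hut⟩ := id hu
  obtain ⟨⟨c', a', hrw⟩, hwt⟩ := id hw
  have hcoe := AEEqFun.coeFn_mul u w
  obtain ⟨hT, hTle⟩ := memLp_top_mul hut hwt
  have hbd : ∀ f : I → ℂ, ∀ k, ∀ Q ∈ 𝓖.sets k, ‖avg m f Q‖ₑ ≤ eLpNorm f ∞ m :=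
    fun f k Q hQ => enorm_avg_le_top (𝓖.measure_pos k Q hQ).ne'
  have hV := incrNorm_mul_le (s := s) h𝓖 hp hq (hbd u) (hbd w)
  set K := incrConst c₁ c₂ s
  have hVK : 𝓖.incrNorm s p q (fun Q => avg m u Q * avg m w Q) ≤
      K * (eLpNorm w ∞ m * 𝓖.besovNorm s p q u + eLpNorm u ∞ m * 𝓖.besovNorm s p q w) := by
    refine hV.trans ?_
    calc _ ≤ eLpNorm w ∞ m * (K * 𝓖.besovNorm s p q u) +
          eLpNorm u ∞ m * (K * 𝓖.besovNorm s p q w) := by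
          gcongr <;> exact incrNorm_le_besovNorm h𝓖 hs hp hq _
      _ = _ := by ring
  have hfin : K * (eLpNorm w ∞ m * 𝓖.besovNorm s p q u +
      eLpNorm u ∞ m * 𝓖.besovNorm s p q w) < ∞ :=
    ENNReal.mul_lt_top (incrConst_lt_top h𝓖 hs) (ENNReal.add_lt_top.2
      ⟨ENNReal.mul_lt_top hwt.eLpNorm_lt_top (besovNorm_lt_top hu.1),
        ENNReal.mul_lt_top hut.eLpNorm_lt_top (besovNorm_lt_top hw.1)⟩)
  obtain ⟨hmem, hle⟩ := besovNorm_le_incrNorm h𝓖 hs hp hq (u := u * w)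
    (hT.mono_exponent le_top) (hVK.trans_lt hfin) (by
      refine (tendsto_step_mul h𝓖 hp hut hwt (hru.incrNorm_le_and_avgConv h𝓖 hs hp hq).2
        (hrw.incrNorm_le_and_avgConv h𝓖 hs hp hq).2).congr fun n => eLpNorm_congr_ae ?_
      filter_upwards [hcoe] with x hx
      simp only [Pi.sub_apply, hx])
  refine ⟨⟨hmem, hT⟩, ?_⟩
  unfold besovLinftyNorm
  -- The two mixed terms bound the Besov part and the product of sup norms bounds the other, as `1 ≤
  -- K`; adding the product of the Besov norms completes the factorization.
  calc _ ≤ K * (eLpNorm w ∞ m * 𝓖.besovNorm s p q u + eLpNorm u ∞ m * 𝓖.besovNorm s p q w) +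
        K * (𝓖.besovNorm s p q u * 𝓖.besovNorm s p q w + eLpNorm u ∞ m * eLpNorm w ∞ m) := by
        refine add_le_add (hle.trans hVK) (hTle.trans ?_)
        exact le_add_self.trans (le_mul_of_one_le_left' one_le_incrConst)
    _ = _ := by ring

/-! ### Completeness -/

/-- The limit `f` comes from `L^∞`. For fixed `i`, `u i - u j` tends to `u i - f` in `L^p`, so its
averages converge and lower semicontinuity bounds `incrNorm` of `u i - f`; the equivalence of norms
turns this into a Besov bound. -/
theorem Grid.complete_besovLinfty [IsFiniteMeasure m] (h𝓖 : 𝓖.IsGood c₁ c₂) (hs : 0 < s)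
    (hp : 1 ≤ p) (hq : 1 ≤ q) (u : ℕ → (I →ₘ[m] ℂ)) (hu : ∀ n, u n ∈ 𝓖.besovLinfty s p q)
    (hcau : ∀ ε : ℝ≥0∞, 0 < ε → ∃ n₀, ∀ i ≥ n₀, ∀ j ≥ n₀,
      𝓖.besovLinftyNorm s p q (u i - u j) < ε) :
    ∃ f ∈ 𝓖.besovLinfty s p q,
      Tendsto (fun n => 𝓖.besovLinftyNorm s p q (u n - f)) atTop (𝓝 0) := by
  let U : ℕ → Lp ℂ ∞ m := fun n => ⟨u n, Lp.mem_Lp_iff_memLp.2 (hu n).2⟩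
  have hcU : CauchySeq U := by
    rw [EMetric.cauchySeq_iff]
    intro ε hε
    obtain ⟨n₀, hn₀⟩ := hcau ε hε
    refine ⟨n₀, fun i hi j hj => lt_of_le_of_lt ?_ (hn₀ i hi j hj)⟩
    rw [Lp.edist_def, ← eLpNorm_congr_ae (AEEqFun.coeFn_sub (u i) (u j))]
    exact le_add_self
  obtain ⟨F, hF⟩ := cauchySeq_tendsto_of_complete hcU
  set f : I →ₘ[m] ℂ := F.1
  have hfT : MemLp f ∞ m := Lp.mem_Lp_iff_memLp.1 F.2
  have hlimT : Tendsto (fun n => eLpNorm (u n - f : I →ₘ[m] ℂ) ∞ m) atTop (𝓝 0) := by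
    refine (tendsto_iff_edist_tendsto_0.1 hF).congr fun n => ?_
    rw [Lp.edist_def, ← eLpNorm_congr_ae (AEEqFun.coeFn_sub (u n) f)]
  have hpT : ∀ w : I →ₘ[m] ℂ, MemLp w ∞ m → MemLp w (ENNReal.ofReal p) m :=
    fun w hw => hw.mono_exponent le_top
  have hsubT : ∀ w w' : I →ₘ[m] ℂ, MemLp w ∞ m → MemLp w' ∞ m →
      MemLp (w - w' : I →ₘ[m] ℂ) ∞ m := fun w w' hw hw' =>
    (hw.sub hw').ae_eq (AEEqFun.coeFn_sub w w').symm
  have hsub : ∀ w w' : I →ₘ[m] ℂ, w ∈ 𝓖.besov s p q → w' ∈ 𝓖.besov s p q →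
      w - w' ∈ 𝓖.besov s p q := by
    intro w w' hw hw'
    rw [sub_eq_add_neg, ← neg_one_smul ℂ w']
    exact add_mem_besov hp hq hw (smul_mem_besov hp hq _ hw')
  have hlimp : Tendsto (fun n => eLpNorm (u n - f : I →ₘ[m] ℂ) (ENNReal.ofReal p) m)
      atTop (𝓝 0) := by
    have e := ENNReal.Tendsto.mul_const (b := m Set.univ ^ (1 / (ENNReal.ofReal p).toReal -
      1 / (∞ : ℝ≥0∞).toReal)) hlimT (Or.inr ?_)
    · rw [zero_mul] at e
      exact tendsto_of_tendsto_of_tendsto_of_le_of_le tendsto_const_nhds e (fun _ => zero_le)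
        fun n => eLpNorm_le_eLpNorm_mul_rpow_measure_univ le_top (AEEqFun.aestronglyMeasurable _)
    · refine ENNReal.rpow_ne_top_of_nonneg ?_ (measure_ne_top m _)
      simp
  have hconv : ∀ i, Tendsto (fun j => eLpNorm
      (⇑(u i - f : I →ₘ[m] ℂ) - ⇑(u i - u j : I →ₘ[m] ℂ)) (ENNReal.ofReal p) m) atTop (𝓝 0) := by
    intro i
    refine hlimp.congr fun j => eLpNorm_congr_ae ?_
    filter_upwards [AEEqFun.coeFn_sub (u i) f, AEEqFun.coeFn_sub (u i) (u j),
      AEEqFun.coeFn_sub (u j) f] with x h1 h2 h3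
    simp only [h1, h2, h3, Pi.sub_apply]
    ring
  have hdiff : ∀ i j, u i - u j ∈ 𝓖.besov s p q := fun i j => hsub _ _ (hu i).1 (hu j).1
  have hdp : ∀ i j, MemLp (u i - u j : I →ₘ[m] ℂ) (ENNReal.ofReal p) m := fun i j =>
    hpT _ (hsubT _ _ (hu i).2 (hu j).2)
  have hAC : ∀ i, 𝓖.AvgConv p (u i - f : I →ₘ[m] ℂ) := by
    intro i
    refine .of_approx h𝓖 hp (hpT _ (hsubT _ _ (hu i).2 hfT)) (hdp i) (fun j => ?_) (hconv i)
    obtain ⟨c, a, h⟩ := hdiff i j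
    exact (h.incrNorm_le_and_avgConv h𝓖 hs hp hq).2
  set K := incrConst c₁ c₂ s with hK
  have hKT : K < ∞ := incrConst_lt_top h𝓖 hs
  have hbound : ∀ ε : ℝ≥0∞, 0 < ε → ε < ∞ → ∃ n₀, ∀ i ≥ n₀,
      u i - f ∈ 𝓖.besov s p q ∧ 𝓖.besovNorm s p q (u i - f) ≤ K * ε := by
    intro ε hε hεT
    obtain ⟨n₀, hn₀⟩ := hcau ε hε
    refine ⟨n₀, fun i hi => ?_⟩
    have hle : 𝓖.incrNorm s p q (avg m (u i - f : I →ₘ[m] ℂ)) ≤ K * ε := by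
      refine incrNorm_le_of_tendsto h𝓖 hq (v := fun j => avg m (u i - u j : I →ₘ[m] ℂ))
        (fun k Q hQ => tendsto_avg hp (hpT _ (hsubT _ _ (hu i).2 hfT)) (hdp i) (hconv i)
          (𝓖.measure_pos k Q hQ).ne') ?_
      filter_upwards [eventually_ge_atTop n₀] with j hj
      refine (incrNorm_le_besovNorm h𝓖 hs hp hq _).trans ?_
      gcongr
      exact le_self_add.trans (hn₀ i hi j hj).le
    obtain ⟨h1, h2⟩ := besovNorm_le_incrNorm h𝓖 hs hp hq (hpT _ (hsubT _ _ (hu i).2 hfT))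
      (hle.trans_lt (ENNReal.mul_lt_top hKT hεT)) (hAC i)
    exact ⟨h1, h2.trans hle⟩
  refine ⟨f, ⟨?_, hfT⟩, ?_⟩
  · obtain ⟨n₀, hn₀⟩ := hbound 1 one_pos ENNReal.one_lt_top
    have := hsub _ _ (hu n₀).1 (hn₀ n₀ le_rfl).1
    rwa [sub_sub_cancel] at this
  · have hB : Tendsto (fun n => 𝓖.besovNorm s p q (u n - f)) atTop (𝓝 0) := by
      rw [ENNReal.tendsto_nhds_zero]
      intro ε hε
      have hK0 : K ≠ 0 := (zero_lt_one.trans_le one_le_incrConst).ne'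
      -- The minimum with `1` keeps the tolerance finite when `ε = ∞`.
      obtain ⟨n₀, hn₀⟩ := hbound (min 1 (ε / K)) (lt_min one_pos (ENNReal.div_pos hε.ne' hKT.ne))
        ((min_le_left _ _).trans_lt ENNReal.one_lt_top)
      filter_upwards [eventually_ge_atTop n₀] with i hi
      refine (hn₀ i hi).2.trans ?_
      calc K * min 1 (ε / K) ≤ K * (ε / K) := by gcongr; exact min_le_right _ _
        _ = ε := ENNReal.mul_div_cancel hK0 hKT.ne
    simpa [besovLinftyNorm] using hB.add hlimT

/-! ### The constants -/

/-- The two factors are compared separately. Since `c₁, c₂ < 1`, `c₁^{-s} c₂^s ≤ c₁^{-2-s} =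
c₁^{1/p-s} c₁^{-2-1/p}`, and the Haar constant is at least `1`; the factor `(1 - c₂^s)⁻¹` is the
second summand of `oscConst`. -/
theorem Grid.incrConst_le (h𝓖 : 𝓖.IsGood c₁ c₂) (hs : 0 < s) :
    incrConst c₁ c₂ s ≤ ENNReal.ofReal (stdConst c₁ c₂ s p) * 𝓖.oscConst c₂ s p q := by
  have h1 := h𝓖.pos
  have h2 : 0 < c₂ := h1.trans h𝓖.lt
  have hr : c₂ ^ s < 1 := Real.rpow_lt_one h2.le h𝓖.lt_one hs
  refine mul_le_mul' ?_ (le_trans ?_ le_add_self)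
  · rw [ENNReal.ofReal_rpow_of_pos h1, ← ENNReal.ofReal_mul (by positivity), ← ENNReal.ofReal_one,
      ← ENNReal.ofReal_add zero_le_one (by positivity)]
    refine ENNReal.ofReal_le_ofReal ?_
    unfold stdConst
    have hH : 1 ≤ haarConst c₁ c₂ := by
      unfold haarConst
      have : 0 ≤ c₂ ^ (1 / 2 : ℝ) / (√2 * c₁ ^ (3 / 2 : ℝ)) := by positivity
      linarith
    refine add_le_add_right ?_ 1
    calc c₁ ^ (-s) * c₂ ^ s ≤ c₁ ^ (-s) * 1 := by gcongr
      _ ≤ c₁ ^ (-2 - s) := by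
          rw [mul_one]
          exact Real.rpow_le_rpow_of_exponent_ge h1 (h𝓖.lt.trans h𝓖.lt_one).le (by linarith)
      _ = 1 * c₁ ^ (1 / p - s) * c₁ ^ (-2 - 1 / p) := by
          rw [one_mul, ← Real.rpow_add h1]
          ring_nf
      _ ≤ _ := by
          gcongr
          exact le_max_right _ _
  · rw [one_div, ENNReal.ofReal_inv_of_pos (by linarith), ENNReal.ofReal_sub _ (by positivity),
      ENNReal.ofReal_one]

theorem Grid.mesh_rpow_le [IsFiniteMeasure m] (h𝓖 : 𝓖.IsGood c₁ c₂) (hs : 0 < s) (k : ℕ) :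
    𝓖.mesh k ^ s ≤ ENNReal.ofReal (c₂ ^ s) ^ k * m Set.univ ^ s := by
  have : 𝓖.mesh k ≤ ENNReal.ofReal c₂ ^ k * m Set.univ := by
    refine iSup₂_le fun Q hQ => ?_
    simpa using measure_descendant_le h𝓖 (Nat.zero_le k) hQ (Q := Set.univ)
      (by simp [h𝓖.level_zero]) (Set.subset_univ Q)
  calc _ ≤ (ENNReal.ofReal c₂ ^ k * m Set.univ) ^ s := by gcongr
    _ = _ := by
        rw [ENNReal.mul_rpow_of_nonneg _ _ hs.le,
          ← ENNReal.ofReal_rpow_of_pos (h𝓖.pos.trans h𝓖.lt), ← ENNReal.rpow_natCast,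
          ← ENNReal.rpow_natCast, ← ENNReal.rpow_mul, ← ENNReal.rpow_mul, mul_comm s]

/-- The exponent `s * p` and the root `1 / p` combine to `mesh k ^ s`, which is dominated by a
geometric sequence. -/
theorem Grid.holderConst_mesh_lt_top [IsFiniteMeasure m] (h𝓖 : 𝓖.IsGood c₁ c₂) (hs : 0 < s)
    (hp : 1 ≤ p) (hq : 1 ≤ q) : holderConst p q (fun k => 𝓖.mesh k ^ (s * p)) < ∞ := by
  have hp0 : p ≠ 0 := by linarith
  have hr := ratio_rpow_lt_one h𝓖 hs
  have hM : m Set.univ ^ s < ∞ := ENNReal.rpow_lt_top_of_nonneg hs.le (measure_ne_top m _)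
  set r := ENNReal.ofReal (c₂ ^ s)
  unfold holderConst
  split_ifs with h
  · refine lt_of_le_of_lt (iSup_le fun k => ?_) hM
    rw [← ENNReal.rpow_mul, mul_assoc, mul_one_div_cancel hp0, mul_one]
    refine (mesh_rpow_le h𝓖 hs k).trans (mul_le_of_le_one_left' (pow_le_one' hr.le k))
  · set t := (ENNReal.conjExponent q).toReal
    -- The conjugate exponent is never `0`, and it is finite because `q > 1` here; otherwise
    -- `toReal` would return `0`.
    have ht : 0 < t := by
      refine ENNReal.toReal_pos ?_ ?_
      · simp [ENNReal.conjExponent]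
      · have : 1 < q := lt_of_le_of_ne hq (Ne.symm h)
        simpa [ENNReal.conjExponent, tsub_eq_zero_iff_le] using this
    refine ENNReal.rpow_lt_top_of_nonneg (by positivity) (ne_of_lt ?_)
    calc _ ≤ ∑' k, (r ^ t) ^ k * (m Set.univ ^ s) ^ t := by
          refine ENNReal.tsum_le_tsum fun k => ?_
          rw [← ENNReal.rpow_mul, show s * p * (t / p) = s * t by field_simp, ENNReal.rpow_mul]
          refine (ENNReal.rpow_le_rpow (mesh_rpow_le h𝓖 hs k) ht.le).trans_eq ?_
          rw [ENNReal.mul_rpow_of_nonneg _ _ ht.le, ← ENNReal.rpow_natCast,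
            ← ENNReal.rpow_natCast, ← ENNReal.rpow_mul, ← ENNReal.rpow_mul r, mul_comm t]
      _ = (1 - r ^ t)⁻¹ * (m Set.univ ^ s) ^ t := by
          rw [ENNReal.tsum_mul_right, ENNReal.tsum_geometric]
      _ < ∞ := by
          refine ENNReal.mul_lt_top ?_ (ENNReal.rpow_lt_top_of_nonneg ht.le hM.ne)
          simpa using ENNReal.rpow_lt_one hr ht

theorem Grid.oscConst_lt_top [IsFiniteMeasure m] (h𝓖 : 𝓖.IsGood c₁ c₂) (hs : 0 < s)
    (hp : 1 ≤ p) (hq : 1 ≤ q) : 𝓖.oscConst c₂ s p q < ∞ := by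
  have hp0 : 0 < p := by linarith
  have hI : m Set.univ ≠ 0 := (𝓖.measure_pos 0 Set.univ (by simp [h𝓖.level_zero])).ne'
  refine ENNReal.add_lt_top.2 ⟨ENNReal.mul_lt_top (ENNReal.mul_lt_top ?_
    (holderConst_mesh_lt_top h𝓖 hs hp hq)) ?_, ENNReal.ofReal_lt_top⟩
  · exact ENNReal.rpow_lt_top_of_nonneg (by positivity) 𝓖.overlap_lt_top.ne
  · exact (ENNReal.rpow_ne_top_of_ne_zero hI (measure_ne_top m _)).lt_top

/-! ### The algebra structure and the main theorem. -/

theorem Grid.isQuasiBanachAlgebra_besovLinfty [IsFiniteMeasure m] (h𝓖 : 𝓖.IsGood c₁ c₂)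
    (hs : 0 < s) (hp : 1 ≤ p) (hq : 1 ≤ q) :
    IsQuasiBanachAlgebra (𝓖.besovLinfty s p q) (𝓖.besovLinftyNorm s p q) where
  zero_mem := ⟨zero_mem_besov h𝓖 hs hp hq, (MemLp.zero (ε := ℂ)).ae_eq AEEqFun.coeFn_zero.symm⟩
  add_mem f hf g hg := ⟨add_mem_besov hp hq hf.1 hg.1,
    (hf.2.add hg.2).ae_eq (AEEqFun.coeFn_add f g).symm⟩
  smul_mem z f hf := ⟨smul_mem_besov hp hq z hf.1,
    (hf.2.const_smul z).ae_eq (AEEqFun.coeFn_smul z f).symm⟩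
  mul_mem f hf g hg := (mul_mem_besovLinfty h𝓖 hs hp hq hf hg).1
  lt_top f hf := ENNReal.add_lt_top.2 ⟨besovNorm_lt_top hf.1, hf.2.eLpNorm_lt_top⟩
  eq_zero_iff f hf := by
    constructor
    · intro h
      have h0 : eLpNorm f ∞ m = 0 := (add_eq_zero.1 h).2
      rw [eLpNorm_eq_zero_iff hf.2.aestronglyMeasurable (by simp)] at h0
      exact AEEqFun.ext (h0.trans AEEqFun.coeFn_zero.symm)
    · rintro rfl
      -- That the zero function has norm zero is homogeneity with the scalar `0`.
      have h0 := besovNorm_smul hp hq (0 : ℂ) hf.1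
      have e : (0 : ℂ) • (0 : I →ₘ[m] ℂ) = 0 := AEEqFun.ext <| by
        filter_upwards [AEEqFun.coeFn_smul (0 : ℂ) (0 : I →ₘ[m] ℂ),
          AEEqFun.coeFn_zero (μ := m) (β := ℂ)] with x h1 h2
        rw [h1, Pi.smul_apply, zero_smul, h2, Pi.zero_apply]
      rw [e, enorm_zero, zero_mul] at h0
      rw [besovLinftyNorm, h0, eLpNorm_congr_ae AEEqFun.coeFn_zero, eLpNorm_zero, add_zero]
  smul_eq z f hf := by
    rw [besovLinftyNorm, besovNorm_smul hp hq z hf.1, eLpNorm_congr_ae (AEEqFun.coeFn_smul z f),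
      eLpNorm_const_smul, ← mul_add, besovLinftyNorm]
  add_le f hf g hg := by
    unfold besovLinftyNorm
    calc _ ≤ (𝓖.besovNorm s p q f + 𝓖.besovNorm s p q g) + (eLpNorm f ∞ m + eLpNorm g ∞ m) := by
          refine add_le_add (besovNorm_add_le hp hq f g) ?_
          rw [eLpNorm_congr_ae (AEEqFun.coeFn_add f g)]
          exact eLpNorm_add_le hf.2.aestronglyMeasurable hg.2.aestronglyMeasurable le_top
      _ = _ := by ring
  mul_le := ⟨(incrConst c₁ c₂ s).toNNReal, fun f hf g hg => by
    rw [ENNReal.coe_toNNReal (incrConst_lt_top h𝓖 hs).ne]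
    exact (mul_mem_besovLinfty h𝓖 hs hp hq hf hg).2⟩
  complete := complete_besovLinfty h𝓖 hs hp hq

end GridBesov

theorem proposition17p1 {I : Type*} [MeasurableSpace I] (m : Measure I) [IsFiniteMeasure m]
    (𝓖 : GridBesov.Grid m) (c₁ c₂ : ℝ) (h𝓖 : 𝓖.IsGood c₁ c₂)
    (s p : ℝ) (q : ℝ≥0∞) (hs : 0 < s) (hsp : s < 1 / p) (hp : 1 ≤ p) (hq : 1 ≤ q) :
    ENNReal.ofReal (GridBesov.stdConst c₁ c₂ s p) * 𝓖.oscConst c₂ s p q < ∞ ∧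
    (∀ f ∈ 𝓖.besovLinfty s p q, ∀ g ∈ 𝓖.besovLinfty s p q,
      f * g ∈ 𝓖.besovLinfty s p q ∧
      𝓖.besovNorm s p q (f * g) + eLpNorm (f * g : I →ₘ[m] ℂ) ∞ m ≤
        ENNReal.ofReal (GridBesov.stdConst c₁ c₂ s p) * 𝓖.oscConst c₂ s p q *
          (𝓖.besovNorm s p q f + eLpNorm f ∞ m) * (𝓖.besovNorm s p q g + eLpNorm g ∞ m)) ∧
    GridBesov.IsQuasiBanachAlgebra (𝓖.besovLinfty s p q) (𝓖.besovLinftyNorm s p q) := by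
  refine ⟨ENNReal.mul_lt_top ENNReal.ofReal_lt_top
    (GridBesov.Grid.oscConst_lt_top h𝓖 hs hp hq), fun f hf g hg => ?_,
    GridBesov.Grid.isQuasiBanachAlgebra_besovLinfty h𝓖 hs hp hq⟩
  obtain ⟨hmem, hle⟩ := GridBesov.Grid.mul_mem_besovLinfty h𝓖 hs hp hq hf hg
  refine ⟨hmem, hle.trans ?_⟩
  unfold GridBesov.Grid.besovLinftyNorm
  gcongr
  exact GridBesov.Grid.incrConst_le h𝓖 hs
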